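/- Let $(M,\Delta)$ be a separable metric space (the data space, of intrinsic dimension $d\ge 1$, $d\in\mathbb N$) with a Borel volume measure $\mathrm{vol}$ for which the ball of radius $r$ has volume $\omega_d r^d$: $\mathrm{vol}(\{y:\Delta(x,y)\le r\})=\omega_d r^d$ for all $x\in M$ and $r>0$, with a constant $\omega_d>0$ (for example $\mathbb R^d$ with Lebesgue measure and the distance of any norm). Let $N$ be a homogeneous Poisson point process on $M$ with constant density $\rho>0$, that is, with intensity measure $\rho\,\mathrm{vol}$. For $x\in M$ let $r_l(x)$ be the distance from $x$ to its $l$-th nearest neighbour among the points of $N$ other than $x$. Let $1\le n_1<n_2$ be integers, let $\dot\mu(x)=r_{n_2}(x)/r_{n_1}(x)$, and let $B(\cdot,\cdot)$ be the Beta function. Then, for an observation $x$, the random variable $\dot\mu=\dot\mu(x)$ has the density $$f(t)=\frac{d\,(t^d-1)^{n_2-n_1-1}}{t^{(n_2-1)d+1}\,B(n_2-n_1,n_1)},\qquad t>1,$$ (and $f(t)=0$ for $t\le 1$); equivalently, $\dot\mu^d-1$ has the Beta prime law with parameters $n_2-n_1$ and $n_1$, whose density is $z^{n_2-n_1-1}(1+z)^{-n_2}/B(n_2-n_1,n_1)$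 on $z>0$. Moreover, for every real $k<d\,n_1$, the $k$-th moment of $\dot\mu$ is finite and $$\mathbb E[\dot\mu^k]=\frac{B(n_2-n_1,\;n_1-k/d)}{B(n_2-n_1,n_1)}.$$ All of this holds in both of the following senses: (i) for an observation at an arbitrary fixed location $x\in M$, the other observations being the points of $N$; (ii) for a typical observation $x$ of the process $N$ itself, sampled in any Borel window $A\subseteq M$ with $0<\mathrm{vol}(A)<\infty$, where probabilities and expectations are those of the Palm distribution: the mean of a nonnegative function $g(N,x)$ is $\mathbb E\big[\sum_{x\in N\cap A}g(N,x)\big]\big/\,\mathbb E\big[\#(N\cap A)\big]$. -/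

import Mathlib

open MeasureTheory ProbabilityTheory Set
open scoped ENNReal

/-- `N` is a Poisson point process on `M` with intensity (mean) measure `Λ`: a random countable
set of points such that the numbers of points in pairwise disjoint measurable sets are independent,
and the number of points in a measurable set `A` has the Poisson law with mean `Λ A` (with the
usual convention that it is almost surely infinite when `Λ A = ∞`). -/
structure IsPoissonPointProcess {Ω M : Type*} [MeasurableSpace Ω] [MeasurableSpace M]
    (N : Ω → Set M) (Λ : Measure M) (P : Measure Ω) : Prop where
  countable : ∀ ω, (N ω).Countable
  measurable_count : ∀ A : Set M, MeasurableSet A → Measurable fun ω => (N ω ∩ A).encard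
  law_count : ∀ A : Set M, MeasurableSet A → Λ A ≠ ∞ →
    HasLaw (fun ω => (N ω ∩ A).encard)
      ((poissonMeasure (Λ A).toNNReal).map (fun n : ℕ => (n : ℕ∞))) P
  count_eq_top : ∀ A : Set M, MeasurableSet A → Λ A = ∞ → ∀ᵐ ω ∂P, (N ω ∩ A).encard = ⊤
  indep_count : ∀ (m : ℕ) (A : Fin m → Set M), (∀ j, MeasurableSet (A j)) →
    Pairwise (fun i j => Disjoint (A i) (A j)) →
    iIndepFun (fun j ω => (N ω ∩ A j).encard) P

/-- The distance `r_l` from `x` to its `l`-th nearest neighbour among the points of `S` other than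
`x` itself, that is, the `l`-th smallest of the distances from `x` to the points of `S \ {x}`
(counted with multiplicity): the least radius for which the ball around `x` holds at least `l` of
these points. -/
noncomputable def nnDist {M : Type*} [MetricSpace M] (S : Set M) (x : M) (l : ℕ) : ℝ :=
  sInf {r : ℝ | 0 ≤ r ∧ (l : ℕ∞) ≤ ((S \ {x}) ∩ Metric.closedBall x r).encard}

/-- The ratio `r_{n₂} / r_{n₁}` of the distances from `x` to its `n₂`-th and its `n₁`-th nearest
neighbours among the points of `S` other than `x`. -/
noncomputable def nnRatio {M : Type*} [MetricSpace M] (S : Set M) (n₁ n₂ : ℕ) (x : M) : ℝ :=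
  nnDist S x n₂ / nnDist S x n₁

/-- The mean value of `f (N ω) x` for a typical point `x` of the random point set `N`, sampled in
the window `A` (expectation under the Palm distribution): the expected sum of `f` over the points
of `N` in `A`, divided by the expected number of these points. -/
noncomputable def typicalMean {Ω M : Type*} [MeasurableSpace Ω] (P : Measure Ω)
    (N : Ω → Set M) (A : Set M) (f : Set M → M → ℝ≥0∞) : ℝ≥0∞ :=
  (∫⁻ ω, ∑' x : ↥(N ω ∩ A), f (N ω) (x : M) ∂P) / ∫⁻ ω, ((N ω ∩ A).encard : ℝ≥0∞) ∂P

/-- The probability that a typical point `x` of the random point set `N`, sampled in the window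
`A`, has `g (N ω) x ∈ B`. -/
noncomputable def typicalProb {Ω M : Type*} [MeasurableSpace Ω] (P : Measure Ω)
    (N : Ω → Set M) (A : Set M) (g : Set M → M → ℝ) (B : Set ℝ) : ℝ≥0∞ :=
  typicalMean P N A (fun S x => B.indicator (fun _ => (1 : ℝ≥0∞)) (g S x))

/-- The density
`d (t ^ d - 1) ^ (n₂ - n₁ - 1) / (t ^ ((n₂ - 1) d + 1) B(n₂ - n₁, n₁))` on `t > 1`. -/
noncomputable def nnRatioDensity (d n₁ n₂ : ℕ) (t : ℝ) : ℝ :=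
  if 1 < t then
    (d : ℝ) * (t ^ d - 1) ^ (n₂ - n₁ - 1) /
      (t ^ ((n₂ - 1) * d + 1) * beta ((n₂ : ℝ) - n₁) n₁)
  else 0

/-- The law on the real line with density `nnRatioDensity`. -/
noncomputable def nnRatioLaw (d n₁ n₂ : ℕ) : Measure ℝ :=
  volume.withDensity fun t => ENNReal.ofReal (nnRatioDensity d n₁ n₂ t)

/-- The Beta prime law with parameters `a, b > 0`: it has the density
`z ^ (a - 1) (1 + z) ^ (- a - b) / B(a, b)` on `z > 0`. -/
noncomputable def betaPrimeLaw (a b : ℝ) : Measure ℝ :=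
  volume.withDensity fun z =>
    ENNReal.ofReal (if 0 < z then z ^ (a - 1) * (1 + z) ^ (-a - b) / beta a b else 0)

/-!
Let `a = ρ c`, so that balls of radius `r` have intensity `a r ^ d`.

**A fixed location.** The map `r ↦ a r ^ d` turns the distances from a fixed location to the points
of the process into a unit rate Poisson process on the half line. Hence
`(a r_{n₁} ^ d, a r_{n₂} ^ d)` is distributed as the pair of the `n₁`-th and `n₂`-th arrival times,
that is, as `(U, U + V)` with independent Gamma variables `U` and `V` of shapes `n₁` and `n₂ - n₁`
(`IsPoissonPointProcess.hasLaw_arrivalLaw`). This is checked on the events `{U ≤ s, U + V > u}`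
with `s ≤ u`: for the process it is a finite sum of products of Poisson probabilities
(`IsPoissonPointProcess.prob_le_count_and_count_lt`), and for the Gamma variables the same sum comes
out of an integral whose primitive telescopes (`hasDerivAt_partialBinomial`,
`arrivalLaw_Iic_Ioi`). Therefore `(r_{n₂} / r_{n₁}) ^ d - 1` has the law of `V / U`, which is Beta
prime (`map_div_gammaMeasure_prod`); the law of the ratio itself follows by a change of variables
(`map_betaPrimeLaw`), and its moments are ratios of normalizing constants of Beta prime densities
(`lintegral_rpow_betaPrimeLaw`).

**A typical point.** By the Mecke formula the points of the process see the same distances as a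
fixed location does (`IsPoissonPointProcess.lintegral_sum_nnDist`). The formula is proved here for
the pair of distances only. The sum of `F (r_{n₁}, r_{n₂})` over the points of the process in `A`,
as a function of `F`, defines a finite measure (`IsPoissonPointProcess.exists_campbell`), so that it
is enough to consider Lipschitz functions `F` with values in `[0, 1]`. Cut `A` into cells `C` of
radius at most `ε`. A cell of intensity `λ` holds two or more points only with a contribution of
order `λ ^ 2`. If it holds exactly one point `x`, the neighbours of `x` are the points outside
of `C`; as the distances are `1`-Lipschitz in the location, they may be measured from the centre of
`C` instead, with an error of order `ε`. The distances from the centre to the points outside of `C`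
are independent of the number of points in `C`, and differ from the distances to all the points
with probability at most `λ` (`IsPoissonPointProcess.campbell_cell_bounds`). The errors sum up to
`O(ε) + O(ε ^ d)`.
-/

section

open scoped Nat NNReal

/-! ### Distances to the nearest points of a locally finite set -/

/-- The least radius for which the closed ball around `x` holds at least `l` points of `S`, the
point `x` itself being counted if it belongs to `S`. -/
noncomputable def kthDist {M : Type*} [MetricSpace M] (S : Set M) (x : M) (l : ℕ) : ℝ :=
  sInf {r : ℝ | 0 ≤ r ∧ (l : ℕ∞) ≤ (S ∩ Metric.closedBall x r).encard}

/-- The set `S` is infinite, and every bounded set contains only finitely many of its points. For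
such sets all the radii `kthDist S x l` are attained infima, so that no junk value occurs. -/
structure IsInfiniteLocallyFinite {M : Type*} [MetricSpace M] (S : Set M) : Prop where
  infinite : S.Infinite
  finite_inter : ∀ x r, (S ∩ Metric.closedBall x r).Finite

section kthDist

variable {M : Type*} [MetricSpace M] {S : Set M} {x y : M} {l : ℕ} {r : ℝ}

lemma nnDist_eq_kthDist : nnDist S x l = kthDist (S \ {x}) x l := rfl

lemma IsInfiniteLocallyFinite.diff (hS : IsInfiniteLocallyFinite S) {C : Set M}
    (hC : (S ∩ C).Finite) : IsInfiniteLocallyFinite (S \ C) where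
  infinite := by
    rw [← sdiff_inter_self_eq_sdiff, inter_comm]
    exact hS.infinite.sdiff hC
  finite_inter x r := (hS.finite_inter x r).subset (inter_subset_inter_left _ sdiff_subset)

lemma IsInfiniteLocallyFinite.of_nat (hS : S.Infinite) (x₀ : M)
    (h : ∀ n : ℕ, (S ∩ Metric.closedBall x₀ n).Finite) : IsInfiniteLocallyFinite S where
  infinite := hS
  finite_inter x r := by
    obtain ⟨n, hn⟩ := exists_nat_ge (r + dist x x₀)
    exact (h n).subset (inter_subset_inter_right _ (Metric.closedBall_subset_closedBall' hn))

lemma kthDist_nonneg : 0 ≤ kthDist S x l := Real.sInf_nonneg fun _ h => h.1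

lemma encard_inter_closedBall_mono {r r' : ℝ} (h : r ≤ r') :
    (S ∩ Metric.closedBall x r).encard ≤ (S ∩ Metric.closedBall x r').encard :=
  encard_le_encard (inter_subset_inter_right _ (Metric.closedBall_subset_closedBall h))

lemma IsInfiniteLocallyFinite.kthDist_le_iff (hS : IsInfiniteLocallyFinite S) :
    kthDist S x l ≤ r ↔ 0 ≤ r ∧ (l : ℕ∞) ≤ (S ∩ Metric.closedBall x r).encard := by
  have hne : {r : ℝ | 0 ≤ r ∧ (l : ℕ∞) ≤ (S ∩ Metric.closedBall x r).encard}.Nonempty := by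
    obtain ⟨t, htS, hcard⟩ := hS.infinite.exists_subset_card_eq l
    obtain ⟨R, hR⟩ := t.finite_toSet.isBounded.subset_closedBall x
    refine ⟨max R 0, le_max_right _ _, ?_⟩
    rw [← hcard, ← encard_coe_eq_coe_finsetCard]
    exact encard_le_encard (subset_inter htS
      (hR.trans (Metric.closedBall_subset_closedBall (le_max_left _ _))))
  refine ⟨fun h => ?_, fun h => csInf_le ⟨0, fun _ h => h.1⟩ h⟩
  refine ⟨kthDist_nonneg.trans h, ?_⟩
  -- local finiteness: slightly larger balls hold no further points
  obtain ⟨r', hr', hsub⟩ : ∃ r' > r, S ∩ Metric.closedBall x r' ⊆ S ∩ Metric.closedBall x r := by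
    have hT : ((S ∩ Metric.closedBall x (r + 1)) \ Metric.closedBall x r).Finite :=
      (hS.finite_inter x (r + 1)).sdiff
    have hev : ∀ᶠ r' in nhdsWithin r (Ioi r),
        ∀ z ∈ (S ∩ Metric.closedBall x (r + 1)) \ Metric.closedBall x r, r' < dist z x := by
      rw [Filter.eventually_all_finite hT]
      intro z hz
      refine mem_nhdsWithin_of_mem_nhds (Iio_mem_nhds ?_)
      simpa using hz.2
    have hev2 : ∀ᶠ r' in nhdsWithin r (Ioi r), r' < r + 1 :=
      mem_nhdsWithin_of_mem_nhds (Iio_mem_nhds (by linarith))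
    obtain ⟨r', ⟨h1, h2⟩, h3⟩ := ((hev.and hev2).and self_mem_nhdsWithin).exists
    refine ⟨r', h3, fun z hz => ⟨hz.1, ?_⟩⟩
    by_contra hzr
    have := h1 z ⟨⟨hz.1, Metric.closedBall_subset_closedBall h2.le hz.2⟩, hzr⟩
    exact absurd hz.2 (by simpa using this)
  obtain ⟨a, ha, har⟩ := exists_lt_of_csInf_lt hne (lt_of_le_of_lt h hr')
  exact ha.2.trans ((encard_inter_closedBall_mono har.le).trans (encard_le_encard hsub))

lemma IsInfiniteLocallyFinite.kthDist_le_add_dist (hS : IsInfiniteLocallyFinite S) :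
    kthDist S y l ≤ kthDist S x l + dist x y := by
  rw [hS.kthDist_le_iff]
  refine ⟨add_nonneg kthDist_nonneg dist_nonneg, ?_⟩
  exact ((hS.kthDist_le_iff (x := x)).1 le_rfl).2.trans (encard_le_encard
    (inter_subset_inter_right _ (Metric.closedBall_subset_closedBall' le_rfl)))

lemma IsInfiniteLocallyFinite.lipschitzWith_kthDist (hS : IsInfiniteLocallyFinite S) (l : ℕ) :
    LipschitzWith 1 fun x => kthDist S x l := by
  refine LipschitzWith.of_le_add fun x y => ?_
  rw [dist_comm]
  exact hS.kthDist_le_add_dist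

lemma kthDist_mono (hS : IsInfiniteLocallyFinite S) {l l' : ℕ} (h : l ≤ l') :
    kthDist S x l ≤ kthDist S x l' := by
  have h' := (hS.kthDist_le_iff (x := x) (l := l')).1 le_rfl
  exact hS.kthDist_le_iff.2 ⟨h'.1, le_trans (by exact_mod_cast h) h'.2⟩

/-- Removing the point `x` itself shifts the count by one. The right-hand side is the one that
depends continuously on `x`. -/
lemma kthDist_diff_singleton (hx : x ∈ S) : kthDist (S \ {x}) x l = kthDist S x (l + 1) := by
  unfold kthDist
  congr 1
  ext r
  refine and_congr_right fun hr => ?_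
  have : ((S \ {x}) ∩ Metric.closedBall x r).encard + 1 = (S ∩ Metric.closedBall x r).encard := by
    have hx' : x ∈ S ∩ Metric.closedBall x r := ⟨hx, Metric.mem_closedBall_self hr⟩
    rw [← encard_sdiff_singleton_add_one hx', inter_sdiff_right_comm]
  rw [← this, Nat.cast_add, Nat.cast_one]
  exact (ENat.add_le_add_iff_right (by simp)).symm

end kthDist

/-! ### Gamma and Beta prime laws -/

lemma measurable_gammaPDF (a r : ℝ) : Measurable (gammaPDF a r) :=
  (measurable_gammaPDFReal a r).ennreal_ofReal

instance sFinite_gammaMeasure (a r : ℝ) : SFinite (gammaMeasure a r) := by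
  unfold gammaMeasure; infer_instance

lemma lintegral_eq_lintegral_scale {u : ℝ} (hu : 0 < u) {f : ℝ → ℝ≥0∞} (hf : Measurable f) :
    ∫⁻ v, f v = ∫⁻ z, ENNReal.ofReal u * f (u * z) := by
  conv_lhs => rw [← Real.smul_map_volume_mul_left hu.ne']
  rw [lintegral_smul_measure, lintegral_map hf (by fun_prop), lintegral_const_mul _ (by fun_prop),
    abs_of_pos hu, smul_eq_mul]

lemma lintegral_eq_setLIntegral_Ioi_zero {f : ℝ → ℝ≥0∞} (hf : ∀ u < 0, f u = 0) :
    ∫⁻ u, f u = ∫⁻ u in Ioi 0, f u := by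
  rw [setLIntegral_congr Ioi_ae_eq_Ici, setLIntegral_eq_of_support_subset]
  intro u hu
  by_contra h
  exact hu (hf u (not_le.1 h))

/-- The density of the Beta prime law, with values in `ℝ≥0∞`. -/
noncomputable def betaPrimePDF (a b z : ℝ) : ℝ≥0∞ :=
  ENNReal.ofReal (if 0 < z then z ^ (a - 1) * (1 + z) ^ (-a - b) / beta a b else 0)

lemma betaPrimeLaw_eq (a b : ℝ) : betaPrimeLaw a b = volume.withDensity (betaPrimePDF a b) := rfl

lemma measurable_betaPrimePDF (a b : ℝ) : Measurable (betaPrimePDF a b) := by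
  unfold betaPrimePDF
  refine (Measurable.ite measurableSet_Ioi ?_ measurable_const).ennreal_ofReal
  fun_prop

/-- Bayes' formula for a rate-one Gamma variable `u` and an independent Gamma variable `u * z`:
the ratio `z` is Beta prime, and given `z` the variable `u` is Gamma of rate `1 + z`. -/
lemma gammaPDF_mul_gammaPDF {a b : ℝ} (ha : 0 < a) (hb : 0 < b) {u z : ℝ} (hu : 0 < u)
    (hz : z ≠ 0) :
    gammaPDF b 1 u * (ENNReal.ofReal u * gammaPDF a 1 (u * z)) =
      betaPrimePDF a b z * gammaPDF (a + b) (1 + z) u := by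
  rcases lt_or_gt_of_ne hz with hz | hz
  · rw [gammaPDF_of_neg (mul_neg_of_pos_of_neg hu hz), betaPrimePDF, if_neg hz.le.not_gt]
    simp
  have hz1 : 0 < 1 + z := by linarith
  rw [gammaPDF_of_nonneg hu.le, gammaPDF_of_nonneg (by positivity), gammaPDF_of_nonneg hu.le,
    betaPrimePDF, if_pos hz]
  have hΓa := Real.Gamma_pos_of_pos ha
  have hΓb := Real.Gamma_pos_of_pos hb
  have hΓab := Real.Gamma_pos_of_pos (add_pos ha hb)
  rw [← ENNReal.ofReal_mul (by positivity), ← ENNReal.ofReal_mul (by positivity),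
    ← ENNReal.ofReal_mul (by have := beta_pos ha hb; positivity)]
  congr 1
  have e1 : Real.exp (-((1 + z) * u)) = Real.exp (-(1 * u)) * Real.exp (-(1 * (u * z))) := by
    rw [← Real.exp_add]; congr 1; ring
  have e2 : (1 + z) ^ (-a - b) = ((1 + z) ^ (a + b))⁻¹ := by
    rw [← Real.rpow_neg hz1.le]; congr 1; ring
  have e3 : u ^ (a + b - 1) = u ^ (b - 1) * u * u ^ (a - 1) := by
    rw [← Real.rpow_add_one hu.ne', ← Real.rpow_add hu]; congr 1; ring
  have h4 : (1 + z) ^ (a + b) ≠ 0 := (Real.rpow_pos_of_pos hz1 _).ne'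
  rw [e1, e2, e3, Real.mul_rpow hu.le hz.le, beta, Real.one_rpow, Real.one_rpow]
  field_simp

/-- The ratio of independent Gamma variables of the same rate has the Beta prime law. -/
lemma map_div_gammaMeasure_prod {a b : ℝ} (ha : 0 < a) (hb : 0 < b) :
    ((gammaMeasure b 1).prod (gammaMeasure a 1)).map (fun p => p.2 / p.1) = betaPrimeLaw a b := by
  ext B hB
  have hdiv : Measurable fun p : ℝ × ℝ => p.2 / p.1 := by fun_prop
  have hBm : Measurable (B.indicator (fun _ => (1 : ℝ≥0∞))) := measurable_const.indicator hB
  have hmb := measurable_gammaPDF b 1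
  have hma := measurable_gammaPDF a 1
  rw [← lintegral_indicator_one hB, ← lintegral_indicator_one hB,
    lintegral_map (by exact hBm) hdiv,
    lintegral_prod _ (by exact (hBm.comp hdiv).aemeasurable)]
  -- substitute `v = u * z` and apply Bayes' formula to the integrand
  have step1 : ∀ u : ℝ, 0 < u → gammaPDF b 1 u *
      ∫⁻ v, B.indicator (1 : ℝ → ℝ≥0∞) (v / u) ∂gammaMeasure a 1 =
      ∫⁻ z, betaPrimePDF a b z * gammaPDF (a + b) (1 + z) u * B.indicator (1 : ℝ → ℝ≥0∞) z := by
    intro u hu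
    have hm1 : Measurable fun v => B.indicator (1 : ℝ → ℝ≥0∞) (v / u) :=
      Measurable.comp (g := B.indicator (1 : ℝ → ℝ≥0∞)) hBm (by fun_prop)
    rw [gammaMeasure, lintegral_withDensity_eq_lintegral_mul _ hma hm1,
      lintegral_eq_lintegral_scale hu (hma.mul hm1), ← lintegral_const_mul]
    · refine lintegral_congr_ae ?_
      filter_upwards [Measure.ae_ne volume 0] with z hz
      rw [← gammaPDF_mul_gammaPDF ha hb hu hz]
      simp only [Pi.mul_apply]
      rw [mul_div_cancel_left₀ _ hu.ne']
      ring
    · exact ((hma.mul hm1).comp (measurable_const_mul u)).const_mul _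
  have hjoint : Measurable fun p : ℝ × ℝ =>
      gammaPDF (a + b) (1 + p.2) p.1 := by
    unfold gammaPDF gammaPDFReal
    refine (Measurable.ite ?_ ?_ measurable_const).ennreal_ofReal
    · exact measurableSet_le measurable_const measurable_fst
    · fun_prop
  calc ∫⁻ u, ∫⁻ v, B.indicator (1 : ℝ → ℝ≥0∞) (v / u) ∂gammaMeasure a 1 ∂gammaMeasure b 1
      = ∫⁻ u, gammaPDF b 1 u *
          ∫⁻ v, B.indicator (1 : ℝ → ℝ≥0∞) (v / u) ∂gammaMeasure a 1 := by
        conv_lhs => rw [gammaMeasure]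
        rw [lintegral_withDensity_eq_lintegral_mul _ hmb]
        · rfl
        · exact Measurable.lintegral_prod_right' (f := fun p : ℝ × ℝ =>
            B.indicator (1 : ℝ → ℝ≥0∞) (p.2 / p.1)) (hBm.comp hdiv)
    _ = ∫⁻ u in Ioi 0, gammaPDF b 1 u *
          ∫⁻ v, B.indicator (1 : ℝ → ℝ≥0∞) (v / u) ∂gammaMeasure a 1 := by
        refine lintegral_eq_setLIntegral_Ioi_zero fun u hu => ?_
        rw [gammaPDF_of_neg hu, zero_mul]
    _ = ∫⁻ u in Ioi 0, ∫⁻ z, betaPrimePDF a b z * gammaPDF (a + b) (1 + z) u *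
          B.indicator (1 : ℝ → ℝ≥0∞) z := setLIntegral_congr_fun measurableSet_Ioi step1
    _ = ∫⁻ z, ∫⁻ u in Ioi 0, betaPrimePDF a b z * gammaPDF (a + b) (1 + z) u *
          B.indicator (1 : ℝ → ℝ≥0∞) z := by
        refine lintegral_lintegral_swap (Measurable.aemeasurable ?_)
        exact (((measurable_betaPrimePDF a b).comp measurable_snd).mul hjoint).mul
          (hBm.comp measurable_snd)
    _ = ∫⁻ z, betaPrimePDF a b z * B.indicator (1 : ℝ → ℝ≥0∞) z := by
        refine lintegral_congr fun z => ?_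
        rcases le_or_gt z 0 with hz | hz
        · simp [betaPrimePDF, hz.not_gt]
        simp_rw [mul_right_comm _ (gammaPDF _ _ _)]
        rw [lintegral_const_mul _ (measurable_gammaPDF _ _), ← lintegral_eq_setLIntegral_Ioi_zero
          fun u hu => gammaPDF_of_neg hu, lintegral_gammaPDF_eq_one (by linarith) (by linarith),
          mul_one]
    _ = ∫⁻ z, B.indicator (1 : ℝ → ℝ≥0∞) z ∂betaPrimeLaw a b := by
        rw [betaPrimeLaw_eq, lintegral_withDensity_eq_lintegral_mul _ (measurable_betaPrimePDF a b)
          (by exact hBm)]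
        rfl

lemma isProbabilityMeasure_betaPrimeLaw {a b : ℝ} (ha : 0 < a) (hb : 0 < b) :
    IsProbabilityMeasure (betaPrimeLaw a b) := by
  have := isProbabilityMeasure_gammaMeasure ha one_pos
  have := isProbabilityMeasure_gammaMeasure hb one_pos
  rw [← map_div_gammaMeasure_prod ha hb]
  exact Measure.isProbabilityMeasure_map (by fun_prop)

/-- Multiplying the density by `(1 + z) ^ κ` shifts the second parameter of the Beta prime law. -/
lemma lintegral_rpow_betaPrimeLaw {a b κ : ℝ} (ha : 0 < a) (hb : 0 < b) (hκ : κ < b) :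
    ∫⁻ z, ENNReal.ofReal ((1 + z) ^ κ) ∂betaPrimeLaw a b =
      ENNReal.ofReal (beta a (b - κ) / beta a b) := by
  have hb' : 0 < b - κ := sub_pos.2 hκ
  have h1 := beta_pos ha hb
  have h2 := beta_pos ha hb'
  have hp := isProbabilityMeasure_betaPrimeLaw ha hb'
  have hmass : ∫⁻ z, betaPrimePDF a (b - κ) z = 1 := by
    have := hp.measure_univ
    rwa [betaPrimeLaw_eq, withDensity_apply _ .univ, setLIntegral_univ] at this
  rw [betaPrimeLaw_eq, lintegral_withDensity_eq_lintegral_mul _ (measurable_betaPrimePDF a b)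
    (by fun_prop)]
  trans ∫⁻ z, ENNReal.ofReal (beta a (b - κ) / beta a b) * betaPrimePDF a (b - κ) z
  · refine lintegral_congr fun z => ?_
    rw [Pi.mul_apply, betaPrimePDF, betaPrimePDF]
    rcases le_or_gt z 0 with hz | hz
    · simp [hz.not_gt]
    have hz1 : 0 < 1 + z := by linarith
    rw [if_pos hz, if_pos hz, ← ENNReal.ofReal_mul (by positivity),
      ← ENNReal.ofReal_mul (by positivity)]
    congr 1
    have e : (1 + z) ^ (-a - (b - κ)) = (1 + z) ^ (-a - b) * (1 + z) ^ κ := by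
      rw [← Real.rpow_add hz1]; congr 1; ring
    rw [e]
    field_simp
  · rw [lintegral_const_mul _ (measurable_betaPrimePDF _ _), hmass, mul_one]

/-- If `z` has the Beta prime law then `t = (1 + z) ^ (1 / d)` has the law `nnRatioLaw`. -/
lemma map_betaPrimeLaw {d n₁ n₂ : ℕ} (hd : 1 ≤ d) (hn₁ : 1 ≤ n₁) (hn : n₁ < n₂) :
    (betaPrimeLaw ((n₂ : ℝ) - n₁) n₁).map (fun z => (1 + z) ^ (1 / d : ℝ)) =
      nnRatioLaw d n₁ n₂ := by
  have hd0 : (d : ℝ) ≠ 0 := by positivity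
  have hd0' : d ≠ 0 := by omega
  have hφ : Measurable fun z : ℝ => (1 + z) ^ (1 / d : ℝ) := by fun_prop
  -- the inverse of the root is `t ↦ t ^ d - 1`, along which the densities are compared
  have himage : (fun t : ℝ => t ^ d - 1) '' Ioi 1 = Ioi 0 := by
    ext z
    constructor
    · rintro ⟨t, ht, rfl⟩
      exact sub_pos.2 (one_lt_pow₀ (show 1 < t from ht) hd0')
    · intro hz
      have hz : 0 < z := hz
      refine ⟨(1 + z) ^ (1 / d : ℝ), Real.one_lt_rpow (by linarith) (by positivity), ?_⟩
      simp only [one_div]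
      rw [Real.rpow_inv_natCast_pow (by linarith) hd0']
      ring
  have hinj : InjOn (fun t : ℝ => t ^ d - 1) (Ioi 1) := by
    intro s hs t ht hst
    have hs : 1 < s := hs
    have ht : 1 < t := ht
    exact (pow_left_inj₀ (by linarith) (by linarith) hd0').1 (sub_left_injective hst)
  ext B hB
  rw [Measure.map_apply hφ hB, betaPrimeLaw_eq, nnRatioLaw,
    withDensity_apply _ (hφ hB), withDensity_apply _ hB, ← lintegral_indicator (hφ hB),
    ← lintegral_indicator hB]
  have hL : ∀ z < 0, ((fun z : ℝ => (1 + z) ^ (1 / d : ℝ)) ⁻¹' B).indicator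
      (betaPrimePDF ((n₂ : ℝ) - n₁) n₁) z = 0 := by
    intro z hz
    simp [betaPrimePDF, hz.le.not_gt]
  rw [lintegral_eq_setLIntegral_Ioi_zero hL, ← himage,
    lintegral_image_eq_lintegral_abs_deriv_mul measurableSet_Ioi
      (fun t _ => ((hasDerivAt_pow d t).sub_const 1).hasDerivWithinAt) hinj,
    ← setLIntegral_eq_of_support_subset (s := Ioi (1 : ℝ))
      (f := B.indicator fun t => ENNReal.ofReal (nnRatioDensity d n₁ n₂ t))]
  swap
  · intro t ht
    by_contra h
    refine ht ?_
    simp [nnRatioDensity, show ¬ 1 < t from h]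
  refine setLIntegral_congr_fun measurableSet_Ioi fun t ht => ?_
  have ht : 1 < t := ht
  have ht0 : 0 < t := by linarith
  have hroot : (1 + (t ^ d - 1)) ^ (1 / d : ℝ) = t := by
    rw [add_sub_cancel, one_div, Real.pow_rpow_inv_natCast ht0.le hd0']
  by_cases htB : t ∈ B
  · rw [indicator_of_mem (by rw [mem_preimage, hroot]; exact htB), indicator_of_mem htB,
      betaPrimePDF, nnRatioDensity, if_pos ht, if_pos (sub_pos.2 (one_lt_pow₀ ht hd0')),
      ← ENNReal.ofReal_mul (abs_nonneg _)]
    congr 1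
    have e1 : (t ^ d - 1) ^ (((n₂ : ℝ) - n₁) - 1) = (t ^ d - 1) ^ (n₂ - n₁ - 1) := by
      rw [← Real.rpow_natCast (t ^ d - 1) (n₂ - n₁ - 1), Nat.cast_sub (by omega),
        Nat.cast_sub hn.le, Nat.cast_one]
    have e2 : (1 + (t ^ d - 1)) ^ (-((n₂ : ℝ) - n₁) - n₁) = (t ^ (d * n₂))⁻¹ := by
      rw [add_sub_cancel, show -((n₂ : ℝ) - n₁) - n₁ = -(n₂ : ℝ) by ring,
        Real.rpow_neg (by positivity), Real.rpow_natCast, pow_mul]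
    have e3 : t ^ (d * n₂) = t ^ ((n₂ - 1) * d + 1) * t ^ (d - 1) := by
      rw [← pow_add]
      congr 1
      obtain ⟨m, rfl⟩ : ∃ m, n₂ = m + 1 := ⟨n₂ - 1, by omega⟩
      obtain ⟨e, rfl⟩ : ∃ e, d = e + 1 := ⟨d - 1, by omega⟩
      simp only [Nat.add_sub_cancel]
      ring
    rw [e1, e2, e3, abs_of_nonneg (by positivity)]
    have := beta_pos (show (0 : ℝ) < (n₂ : ℝ) - n₁ from sub_pos.2 (by exact_mod_cast hn))
      (show (0 : ℝ) < n₁ by exact_mod_cast hn₁)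
    field_simp
  · rw [indicator_of_notMem (by rw [mem_preimage, hroot]; exact htB), indicator_of_notMem htB,
      mul_zero]

/-! ### Arrival times of a unit rate Poisson process -/

lemma gammaPDF_natCast_add_one (n : ℕ) {v : ℝ} (hv : 0 ≤ v) :
    gammaPDF (n + 1) 1 v = ENNReal.ofReal (v ^ n / n ! * Real.exp (-v)) := by
  rw [gammaPDF_of_nonneg hv, Real.Gamma_nat_eq_factorial, add_sub_cancel_right, Real.rpow_natCast,
    Real.one_rpow, one_mul]
  congr 1
  ring

lemma ae_pos_gammaMeasure (a r : ℝ) : ∀ᵐ v ∂gammaMeasure a r, 0 < v := by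
  rw [gammaMeasure, ae_withDensity_iff (measurable_gammaPDF a r)]
  filter_upwards [Measure.ae_ne volume 0] with v hv0 hv
  by_contra h
  exact hv (gammaPDF_of_neg (lt_of_le_of_ne (not_lt.1 h) hv0))

lemma hasDerivAt_pow_div_factorial (n : ℕ) (s : ℝ) :
    HasDerivAt (fun s : ℝ => s ^ (n + 1) / (n + 1)!) (s ^ n / n !) s := by
  refine ((hasDerivAt_pow (n + 1) s).div_const _).congr_deriv ?_
  rw [Nat.factorial_succ]
  have : (n ! : ℝ) ≠ 0 := by positivity
  push_cast
  field_simp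

lemma hasDerivAt_sub_pow_div_factorial (n : ℕ) (u s : ℝ) :
    HasDerivAt (fun s : ℝ => (u - s) ^ (n + 1) / (n + 1)!) (-((u - s) ^ n / n !)) s := by
  refine ((hasDerivAt_pow_div_factorial n (u - s)).comp s
    ((hasDerivAt_id s).const_sub u)).congr_deriv ?_
  ring

/-- The terms of degree `k + j` of `exp s * exp (u - s)` whose exponent of `s` is at least `k`. -/
noncomputable def partialBinomial (k j : ℕ) (u s : ℝ) : ℝ :=
  ∑ i ∈ Finset.range (j + 1), s ^ (k + i) / (k + i)! * ((u - s) ^ (j - i) / (j - i)!)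

lemma partialBinomial_succ (k j : ℕ) (u s : ℝ) :
    partialBinomial k (j + 1) u s =
      s ^ k / k ! * ((u - s) ^ (j + 1) / (j + 1)!) + partialBinomial (k + 1) j u s := by
  rw [partialBinomial, Finset.sum_range_succ', add_comm, partialBinomial]
  simp [add_assoc, add_comm 1]

/-- The derivative in `s` telescopes to its boundary term. -/
lemma hasDerivAt_partialBinomial (k j : ℕ) (u s : ℝ) :
    HasDerivAt (partialBinomial (k + 1) j u) (s ^ k / k ! * ((u - s) ^ j / j !)) s := by
  induction j generalizing k with
  | zero =>
    have : partialBinomial (k + 1) 0 u = fun s : ℝ => s ^ (k + 1) / (k + 1)! := by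
      ext s; simp [partialBinomial]
    rw [this]
    simpa using hasDerivAt_pow_div_factorial k s
  | succ j ih =>
    have : partialBinomial (k + 1) (j + 1) u = fun s : ℝ =>
        s ^ (k + 1) / (k + 1)! * ((u - s) ^ (j + 1) / (j + 1)!) +
          partialBinomial (k + 1 + 1) j u s := by
      ext s; exact partialBinomial_succ _ _ _ _
    rw [this]
    refine (((hasDerivAt_pow_div_factorial k s).mul
      (hasDerivAt_sub_pow_div_factorial j u s)).add (ih (k + 1))).congr_deriv ?_
    ring

lemma partialBinomial_zero (k j : ℕ) (u : ℝ) : partialBinomial (k + 1) j u 0 = 0 :=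
  Finset.sum_eq_zero fun i _ => by rw [zero_pow (by omega), zero_div, zero_mul]

/-- The fundamental theorem of calculus for integrals against a Gamma law of integral shape. -/
lemma lintegral_Iic_gammaMeasure_eq_sub {n : ℕ} {s : ℝ} (hs : 0 ≤ s) {g F : ℝ → ℝ}
    (hg : Continuous g) (hg0 : ∀ v, 0 ≤ v → v ≤ s → 0 ≤ g v)
    (hF : ∀ v, HasDerivAt F (v ^ n / n ! * Real.exp (-v) * g v) v) :
    ∫⁻ v in Iic s, ENNReal.ofReal (g v) ∂gammaMeasure (n + 1) 1 =
      ENNReal.ofReal (F s - F 0) := by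
  have hcont : Continuous fun v : ℝ => v ^ n / n ! * Real.exp (-v) * g v := by fun_prop
  rw [← intervalIntegral.integral_eq_sub_of_hasDerivAt (fun v _ => hF v)
    (hcont.intervalIntegrable 0 s), intervalIntegral.integral_of_le hs,
    ofReal_integral_eq_lintegral_ofReal (hcont.integrableOn_Ioc)]
  swap
  · filter_upwards [ae_restrict_mem measurableSet_Ioc] with v hv
    have := hg0 v hv.1.le hv.2
    have := hv.1.le
    positivity
  rw [gammaMeasure, restrict_withDensity measurableSet_Iic,
    lintegral_withDensity_eq_lintegral_mul _ (measurable_gammaPDF _ _) (by fun_prop),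
    ← lintegral_indicator measurableSet_Iic, ← lintegral_indicator measurableSet_Ioc]
  refine lintegral_congr_ae ?_
  filter_upwards [Measure.ae_ne volume 0] with v hv
  rcases lt_or_gt_of_ne hv with hv | hv
  · rw [indicator_of_notMem (s := Ioc 0 s) (fun h => h.1.not_gt hv), indicator_apply]
    simp [gammaPDF_of_neg hv]
  · by_cases hvs : v ≤ s
    · rw [indicator_of_mem (s := Iic s) hvs, indicator_of_mem (s := Ioc 0 s) ⟨hv, hvs⟩,
        Pi.mul_apply, gammaPDF_natCast_add_one n hv.le, ← ENNReal.ofReal_mul (by positivity)]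
    · rw [indicator_of_notMem (s := Iic s) hvs, indicator_of_notMem (s := Ioc 0 s) fun h => hvs h.2]

lemma hasDerivAt_sum_pow_div_factorial (n : ℕ) (v : ℝ) :
    HasDerivAt (fun v : ℝ => ∑ i ∈ Finset.range (n + 1), v ^ i / i !)
      (∑ i ∈ Finset.range n, v ^ i / i !) v := by
  simp_rw [Finset.sum_range_succ' _ n]
  simpa using (HasDerivAt.fun_sum fun i _ => hasDerivAt_pow_div_factorial i v).add_const
    (∑ i ∈ Finset.range 1, v ^ 0 / 0!)

/-- The distribution function of the Gamma law of integral shape. -/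
lemma gammaMeasure_Iic {n : ℕ} {s : ℝ} (hs : 0 ≤ s) :
    gammaMeasure (n + 1) 1 (Iic s) =
      ENNReal.ofReal (1 - Real.exp (-s) * ∑ i ∈ Finset.range (n + 1), s ^ i / i !) := by
  have h := lintegral_Iic_gammaMeasure_eq_sub (n := n) hs (g := fun _ => 1)
    (F := fun v => -(Real.exp (-v) * ∑ i ∈ Finset.range (n + 1), v ^ i / i !))
    continuous_const (fun _ _ _ => zero_le_one) (fun v => by
      refine ((((hasDerivAt_neg v).exp).mul
        (hasDerivAt_sum_pow_div_factorial n v)).neg).congr_deriv ?_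
      rw [Finset.sum_range_succ]
      ring)
  simp only [ENNReal.ofReal_one, lintegral_const, one_mul, Measure.restrict_apply .univ,
    univ_inter] at h
  rw [h]
  congr 1
  simp [Finset.sum_range_succ']
  ring

lemma gammaMeasure_Ioi {n : ℕ} {s : ℝ} (hs : 0 ≤ s) :
    gammaMeasure (n + 1) 1 (Ioi s) =
      ENNReal.ofReal (Real.exp (-s) * ∑ i ∈ Finset.range (n + 1), s ^ i / i !) := by
  have := isProbabilityMeasure_gammaMeasure (show (0 : ℝ) < n + 1 by positivity) one_pos
  rw [← compl_Iic, prob_compl_eq_one_sub measurableSet_Iic, gammaMeasure_Iic hs,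
    ← ENNReal.ofReal_one, ← ENNReal.ofReal_sub _]
  · congr 1; ring
  · have : Real.exp (-s) * ∑ i ∈ Finset.range (n + 1), s ^ i / i ! ≤ Real.exp (-s) * Real.exp s :=
      mul_le_mul_of_nonneg_left (Real.sum_le_exp_of_nonneg hs _) (Real.exp_pos _).le
    rw [← Real.exp_add, neg_add_cancel, Real.exp_zero] at this
    linarith

/-- The joint law of the `(n + 1)`-st and the `(n + m + 2)`-nd arrival times of a unit rate Poisson
process on the half line: partial sums of two independent Gamma variables of integral shape. -/
noncomputable def arrivalLaw (n m : ℕ) : Measure (ℝ × ℝ) :=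
  ((gammaMeasure (n + 1) 1).prod (gammaMeasure (m + 1) 1)).map fun p => (p.1, p.1 + p.2)

instance (n m : ℕ) : IsProbabilityMeasure (arrivalLaw n m) := by
  have := isProbabilityMeasure_gammaMeasure (show (0 : ℝ) < n + 1 by positivity) one_pos
  have := isProbabilityMeasure_gammaMeasure (show (0 : ℝ) < m + 1 by positivity) one_pos
  exact Measure.isProbabilityMeasure_map (by fun_prop)

lemma ae_arrivalLaw (n m : ℕ) : ∀ᵐ p ∂arrivalLaw n m, 0 < p.1 ∧ p.1 < p.2 := by
  rw [arrivalLaw, ae_map_iff (by fun_prop)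
    (p := fun p : ℝ × ℝ => 0 < p.1 ∧ p.1 < p.2)
    ((measurableSet_lt measurable_const measurable_fst).inter
      (measurableSet_lt measurable_fst measurable_snd))]
  filter_upwards [Measure.quasiMeasurePreserving_fst.ae (ae_pos_gammaMeasure _ _),
    Measure.quasiMeasurePreserving_snd.ae (ae_pos_gammaMeasure _ _)] with p h1 h2
  exact ⟨h1, lt_add_of_pos_right _ h2⟩

lemma arrivalLaw_Iic_univ (n m : ℕ) {s : ℝ} (hs : 0 ≤ s) :
    arrivalLaw n m (Iic s ×ˢ univ) =
      ENNReal.ofReal (1 - Real.exp (-s) * ∑ i ∈ Finset.range (n + 1), s ^ i / i !) := by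
  have := isProbabilityMeasure_gammaMeasure (show (0 : ℝ) < m + 1 by positivity) one_pos
  rw [arrivalLaw, Measure.map_apply (by fun_prop) (measurableSet_Iic.prod .univ),
    ← gammaMeasure_Iic hs]
  have : (fun p : ℝ × ℝ => (p.1, p.1 + p.2)) ⁻¹' Iic s ×ˢ univ = Iic s ×ˢ univ := by ext; simp
  rw [this, Measure.prod_prod, measure_univ, mul_one]

/-- The event that the first of the two arrivals is before `s` and the second is after `u`, in the
form in which it appears as a sum of Poisson probabilities. -/
lemma arrivalLaw_Iic_Ioi (n m : ℕ) {s u : ℝ} (hs : 0 ≤ s) (hsu : s ≤ u) :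
    arrivalLaw n m (Iic s ×ˢ Ioi u) =
      ENNReal.ofReal (Real.exp (-u) *
        ∑ j ∈ Finset.range (m + 1), partialBinomial (n + 1) j u s) := by
  have hme : MeasurableSet ((fun p : ℝ × ℝ => (p.1, p.1 + p.2)) ⁻¹' Iic s ×ˢ Ioi u) :=
    (by fun_prop : Measurable fun p : ℝ × ℝ => (p.1, p.1 + p.2))
      (measurableSet_Iic.prod measurableSet_Ioi)
  rw [arrivalLaw, Measure.map_apply (by fun_prop) (measurableSet_Iic.prod measurableSet_Ioi),
    Measure.prod_apply hme]
  have hslice : ∀ v, gammaMeasure (m + 1) 1 (Prod.mk v ⁻¹'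
      ((fun p : ℝ × ℝ => (p.1, p.1 + p.2)) ⁻¹' Iic s ×ˢ Ioi u)) =
      (Iic s).indicator (fun v => ENNReal.ofReal
        (Real.exp (-(u - v)) * ∑ i ∈ Finset.range (m + 1), (u - v) ^ i / i !)) v := by
    intro v
    by_cases hv : v ≤ s
    · rw [indicator_of_mem (s := Iic s) hv, ← gammaMeasure_Ioi (by linarith)]
      congr 1
      ext w
      simp [hv, sub_lt_iff_lt_add']
    · rw [indicator_of_notMem (s := Iic s) hv]
      convert measure_empty (μ := gammaMeasure (m + 1) 1)
      ext w
      simp [hv]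
  simp_rw [hslice]
  rw [lintegral_indicator measurableSet_Iic, lintegral_Iic_gammaMeasure_eq_sub hs (by fun_prop)
    (F := fun v => Real.exp (-u) * ∑ j ∈ Finset.range (m + 1), partialBinomial (n + 1) j u v)]
  · simp [partialBinomial_zero]
  · intro v hv hvs
    have : 0 ≤ u - v := by linarith
    positivity
  · intro v
    refine ((HasDerivAt.fun_sum fun j _ => hasDerivAt_partialBinomial n j u v).const_mul
      (Real.exp (-u))).congr_deriv ?_
    rw [← Finset.mul_sum, show Real.exp (-u) = Real.exp (-v) * Real.exp (-(u - v)) by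
      rw [← Real.exp_add]; congr 1; ring]
    ring

/-- The ratio of the two arrival times, minus one, has the Beta prime law. -/
lemma map_div_sub_one_arrivalLaw (n m : ℕ) :
    (arrivalLaw n m).map (fun p => p.2 / p.1 - 1) = betaPrimeLaw (m + 1) (n + 1) := by
  rw [← map_div_gammaMeasure_prod (by positivity) (by positivity), arrivalLaw,
    Measure.map_map (by fun_prop) (by fun_prop)]
  refine Measure.map_congr ?_
  filter_upwards [Measure.quasiMeasurePreserving_fst.ae (ae_pos_gammaMeasure _ _)] with p h1
  have : p.1 ≠ 0 := h1.ne'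
  simp only [Function.comp]
  field_simp
  ring

/-! ### Laws of pairs, measurability, and Poisson counts -/

lemma MeasureTheory.Measure.ext_of_Iic_prod_Iic {μ ν : Measure (ℝ × ℝ)} [IsFiniteMeasure μ]
    (h : ∀ s u, μ (Iic s ×ˢ Iic u) = ν (Iic s ×ˢ Iic u)) (huniv : μ univ = ν univ) : μ = ν := by
  have hspan : IsCountablySpanning (range (Iic : ℝ → Set ℝ)) := by
    refine ⟨fun n : ℕ => Iic (n : ℝ), fun n => mem_range_self _, ?_⟩
    ext x
    simpa using exists_nat_ge x
  have hgen : MeasurableSpace.generateFrom (range (Iic : ℝ → Set ℝ)) = Real.measurableSpace :=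
    (borel_eq_generateFrom_Iic ℝ).symm
  refine ext_of_generate_finite (image2 (· ×ˢ ·) (range Iic) (range Iic))
    (generateFrom_eq_prod hgen hgen hspan hspan).symm (isPiSystem_Iic.prod isPiSystem_Iic) ?_ huniv
  rintro _ ⟨_, ⟨s, rfl⟩, _, ⟨u, rfl⟩, rfl⟩
  exact h s u

/-- Two laws of pairs `0 ≤ p.1 ≤ p.2` agree if they agree on the events `p.1 ≤ s` and, for `s ≤ u`,
on the events `p.1 ≤ s, u < p.2`. -/
lemma MeasureTheory.Measure.ext_of_Iic_prod_Ioi {μ ν : Measure (ℝ × ℝ)}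
    [IsProbabilityMeasure μ] [IsProbabilityMeasure ν]
    (hμ : ∀ᵐ p ∂μ, 0 ≤ p.1 ∧ p.1 ≤ p.2) (hν : ∀ᵐ p ∂ν, 0 ≤ p.1 ∧ p.1 ≤ p.2)
    (h1 : ∀ s, 0 ≤ s → μ (Iic s ×ˢ univ) = ν (Iic s ×ˢ univ))
    (h2 : ∀ s u, 0 ≤ s → s ≤ u → μ (Iic s ×ˢ Ioi u) = ν (Iic s ×ˢ Ioi u)) : μ = ν := by
  have hneg : ∀ {ξ : Measure (ℝ × ℝ)}, (∀ᵐ p ∂ξ, 0 ≤ p.1 ∧ p.1 ≤ p.2) →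
      ∀ s u, min s u < 0 → ξ (Iic s ×ˢ Iic u) = 0 := by
    intro ξ hξ s u hsu
    rw [measure_eq_zero_iff_ae_notMem]
    filter_upwards [hξ] with p hp hmem
    exact absurd (le_min (hp.1.trans hmem.1) (hp.1.trans (hp.2.trans hmem.2))) hsu.not_ge
  have hmin : ∀ {ξ : Measure (ℝ × ℝ)}, (∀ᵐ p ∂ξ, 0 ≤ p.1 ∧ p.1 ≤ p.2) →
      ∀ s u, ξ (Iic s ×ˢ Iic u) = ξ (Iic (min s u) ×ˢ Iic u) := by
    intro ξ hξ s u
    refine measure_congr ?_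
    filter_upwards [hξ] with p hp
    refine propext ⟨fun h => ⟨le_min h.1 (hp.2.trans h.2), h.2⟩, fun h => ⟨?_, h.2⟩⟩
    exact (mem_Iic.1 h.1).trans (min_le_left _ _)
  have hsub : ∀ (ξ : Measure (ℝ × ℝ)) [IsProbabilityMeasure ξ] (s u : ℝ),
      ξ (Iic s ×ˢ Iic u) = ξ (Iic s ×ˢ univ) - ξ (Iic s ×ˢ Ioi u) := by
    intro ξ _ s u
    rw [← measure_sdiff (prod_mono_right (subset_univ _))
      (measurableSet_Iic.prod measurableSet_Ioi).nullMeasurableSet (measure_ne_top _ _)]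
    congr 1
    ext p
    simp only [mem_prod, mem_Iic, mem_univ, mem_sdiff, mem_Ioi, and_true, not_and, not_lt]
    tauto
  refine Measure.ext_of_Iic_prod_Iic (fun s u => ?_) (by simp)
  rcases lt_or_ge (min s u) 0 with h | h
  · rw [hneg hμ s u h, hneg hν s u h]
  · rw [hmin hμ, hmin hν, hsub μ, hsub ν, h1 _ h, h2 _ _ h (min_le_right _ _)]

section RandomSet

variable {Ω M : Type*} [MeasurableSpace Ω] [MetricSpace M] [MeasurableSpace M] [BorelSpace M]
  {N : Ω → Set M}

lemma measurableSet_isInfiniteLocallyFinite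
    (hN : ∀ A : Set M, MeasurableSet A → Measurable fun ω => (N ω ∩ A).encard) (x₀ : M) :
    MeasurableSet {ω | IsInfiniteLocallyFinite (N ω)} := by
  have : {ω | IsInfiniteLocallyFinite (N ω)} = {ω | (N ω ∩ univ).encard = ⊤} ∩
      ⋂ n : ℕ, {ω | (N ω ∩ Metric.closedBall x₀ n).encard ≠ ⊤} := by
    ext ω
    simp only [mem_ofPred_eq, mem_inter_iff, mem_iInter, inter_univ, encard_ne_top_iff,
      encard_eq_top_iff]
    exact ⟨fun h => ⟨h.infinite, fun n => h.finite_inter _ _⟩,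
      fun h => .of_nat h.1 x₀ h.2⟩
  rw [this]
  refine (hN univ .univ (measurableSet_singleton _)).inter (.iInter fun n => ?_)
  exact hN _ Metric.isClosed_closedBall.measurableSet (measurableSet_singleton ⊤).compl

/-- On the event of local finiteness, the distance to the `l`-th nearest point is measurable. -/
lemma measurable_indicator_kthDist
    (hN : ∀ A : Set M, MeasurableSet A → Measurable fun ω => (N ω ∩ A).encard) (x : M) (l : ℕ) :
    Measurable ({ω | IsInfiniteLocallyFinite (N ω)}.indicator fun ω => kthDist (N ω) x l) := by
  have hG := measurableSet_isInfiniteLocallyFinite hN x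
  refine measurable_of_Iic fun r => ?_
  rcases lt_or_ge r 0 with hr | hr
  · convert MeasurableSet.empty
    ext ω
    simp only [mem_preimage, mem_Iic, mem_empty_iff_false, iff_false, not_le]
    exact hr.trans_le (indicator_nonneg (fun _ _ => kthDist_nonneg) _)
  · have : ({ω | IsInfiniteLocallyFinite (N ω)}.indicator fun ω => kthDist (N ω) x l) ⁻¹' Iic r =
        {ω | IsInfiniteLocallyFinite (N ω)}ᶜ ∪ ({ω | IsInfiniteLocallyFinite (N ω)} ∩
          {ω | (l : ℕ∞) ≤ (N ω ∩ Metric.closedBall x r).encard}) := by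
      ext ω
      by_cases h : IsInfiniteLocallyFinite (N ω)
      · simp [h, h.kthDist_le_iff, hr]
      · simp [h, hr]
    rw [this]
    have hcount := hN (Metric.closedBall x r) Metric.isClosed_closedBall.measurableSet
    exact hG.compl.union (hG.inter (hcount (t := Ici (l : ℕ∞)) .of_discrete))

lemma aemeasurable_kthDist {P : Measure Ω}
    (hN : ∀ A : Set M, MeasurableSet A → Measurable fun ω => (N ω ∩ A).encard)
    (hG : ∀ᵐ ω ∂P, IsInfiniteLocallyFinite (N ω)) (x : M) (l : ℕ) :
    AEMeasurable (fun ω => kthDist (N ω) x l) P := by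
  refine ⟨_, measurable_indicator_kthDist hN x l, ?_⟩
  filter_upwards [hG] with ω hω
  rw [indicator_of_mem (by exact hω)]

end RandomSet

namespace IsPoissonPointProcess

section Counts

variable {Ω M : Type*} [MeasurableSpace Ω] {P : Measure Ω}
  [MeasurableSpace M] {Λ : Measure M} {N : Ω → Set M} {A B : Set M}

lemma prob_count_eq (hN : IsPoissonPointProcess N Λ P) (hA : MeasurableSet A) (hΛ : Λ A ≠ ∞)
    (k : ℕ) : P {ω | (N ω ∩ A).encard = k} =
      ENNReal.ofReal (Real.exp (-(Λ A).toReal) * (Λ A).toReal ^ k / k !) := by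
  have hm : Measurable fun n : ℕ => (n : ℕ∞) := .of_discrete
  rw [(hN.law_count A hA hΛ).measure_eq (p := fun n => n = k) (measurableSet_singleton (k : ℕ∞)),
    Measure.map_apply hm .of_discrete]
  have : (fun n : ℕ => (n : ℕ∞)) ⁻¹' {n | n = k} = {k} := by ext; simp
  rw [this, poissonMeasure_singleton]
  rfl

lemma ae_finite (hN : IsPoissonPointProcess N Λ P) (hA : MeasurableSet A) (hΛ : Λ A ≠ ∞) :
    ∀ᵐ ω ∂P, (N ω ∩ A).Finite := by
  have hm : Measurable fun n : ℕ => (n : ℕ∞) := .of_discrete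
  have := (hN.law_count A hA hΛ).ae_iff (p := fun n => n ≠ ⊤) .of_discrete
  simp_rw [encard_ne_top_iff] at this
  rw [this, ae_map_iff hm.aemeasurable .of_discrete]
  simp

lemma ae_inter_eq_empty (hN : IsPoissonPointProcess N Λ P) [IsProbabilityMeasure P]
    (hA : MeasurableSet A) (hΛ : Λ A = 0) : ∀ᵐ ω ∂P, N ω ∩ A = ∅ := by
  have h := hN.prob_count_eq hA (by simp [hΛ]) 0
  simp only [hΛ, CharP.cast_eq_zero, encard_eq_zero] at h
  have hm : MeasurableSet {ω | N ω ∩ A = ∅} := by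
    simp_rw [← encard_eq_zero]
    exact hN.measurable_count A hA (measurableSet_singleton 0)
  exact (prob_compl_eq_zero_iff hm).2 (by simpa using h)

lemma indepFun_count (hN : IsPoissonPointProcess N Λ P)
    (hA : MeasurableSet A) (hB : MeasurableSet B) (hAB : Disjoint A B) :
    IndepFun (fun ω => (N ω ∩ A).encard) (fun ω => (N ω ∩ B).encard) P := by
  have h := hN.indep_count 2 ![A, B] (by simp [Fin.forall_fin_two, hA, hB]) (by
    intro i j hij
    fin_cases i <;> fin_cases j <;> simp_all [disjoint_comm])
  exact h.indepFun (i := 0) (j := 1) (by simp)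

lemma prob_count_eq_and_count_eq (hN : IsPoissonPointProcess N Λ P)
    (hA : MeasurableSet A) (hB : MeasurableSet B) (hAB : Disjoint A B) (hΛA : Λ A ≠ ∞)
    (hΛB : Λ B ≠ ∞) (k l : ℕ) : P {ω | (N ω ∩ A).encard = k ∧ (N ω ∩ B).encard = l} =
      ENNReal.ofReal (Real.exp (-(Λ A).toReal) * (Λ A).toReal ^ k / k !) *
      ENNReal.ofReal (Real.exp (-(Λ B).toReal) * (Λ B).toReal ^ l / l !) := by
  rw [← hN.prob_count_eq hA hΛA, ← hN.prob_count_eq hB hΛB]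
  exact (hN.indepFun_count hA hB hAB).measure_inter_preimage_eq_mul {(k : ℕ∞)} {(l : ℕ∞)}
    (measurableSet_singleton _) (measurableSet_singleton _)

lemma prob_le_count (hN : IsPoissonPointProcess N Λ P) [IsProbabilityMeasure P]
    (hA : MeasurableSet A) (hΛ : Λ A ≠ ∞) (k : ℕ) :
    P {ω | (k : ℕ∞) ≤ (N ω ∩ A).encard} =
      ENNReal.ofReal (1 - Real.exp (-(Λ A).toReal) *
        ∑ i ∈ Finset.range k, (Λ A).toReal ^ i / i !) := by
  have hc : {ω | (k : ℕ∞) ≤ (N ω ∩ A).encard} =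
      (⋃ i ∈ Finset.range k, {ω | (N ω ∩ A).encard = i})ᶜ := by
    ext ω
    simp only [mem_ofPred_eq, mem_compl_iff, mem_iUnion, Finset.mem_range, exists_prop, not_exists,
      not_and]
    constructor
    · rintro h i hi h'
      rw [h', Nat.cast_le] at h
      omega
    · intro h
      by_contra! hlt
      obtain ⟨i, hi⟩ := ENat.ne_top_iff_exists.1 hlt.ne_top
      rw [← hi, Nat.cast_lt] at hlt
      exact h i hlt hi.symm
  have hmeas : ∀ i : ℕ, MeasurableSet {ω | (N ω ∩ A).encard = i} := fun i =>
    hN.measurable_count A hA (measurableSet_singleton _)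
  rw [hc, prob_compl_eq_one_sub (Finset.measurableSet_biUnion _ fun i _ => hmeas i),
    measure_biUnion_finset _ fun i _ => hmeas i]
  · simp_rw [hN.prob_count_eq hA hΛ, mul_div_assoc]
    rw [← ENNReal.ofReal_sum_of_nonneg fun i _ => by positivity, ← ENNReal.ofReal_one,
      ← ENNReal.ofReal_sub _ (Finset.sum_nonneg fun i _ => by positivity), Finset.mul_sum]
  · intro i _ j _ hij
    refine Set.disjoint_left.2 fun ω hi hj => hij ?_
    simp only [mem_ofPred_eq] at hi hj
    exact_mod_cast hi.symm.trans hj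

/-- The sum over the numbers of points in `A` and in `B \ A`, grouped by the number in `B`. -/
lemma prob_le_count_and_count_lt (hN : IsPoissonPointProcess N Λ P)
    (hA : MeasurableSet A) (hB : MeasurableSet B) (hAB : A ⊆ B) (hΛ : Λ B ≠ ∞) (n m : ℕ) :
    P {ω | ((n + 1 : ℕ) : ℕ∞) ≤ (N ω ∩ A).encard ∧ (N ω ∩ B).encard < (n + m + 2 : ℕ)} =
      ENNReal.ofReal (Real.exp (-(Λ B).toReal) * ∑ j ∈ Finset.range (m + 1),
        partialBinomial (n + 1) j (Λ B).toReal (Λ A).toReal) := by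
  have hΛA : Λ A ≠ ∞ := measure_ne_top_of_subset hAB hΛ
  have hD : MeasurableSet (B \ A) := hB.diff hA
  have hΛD : Λ (B \ A) ≠ ∞ := measure_ne_top_of_subset sdiff_subset hΛ
  have hsub : (Λ (B \ A)).toReal = (Λ B).toReal - (Λ A).toReal := by
    rw [measure_sdiff hAB hA.nullMeasurableSet hΛA, ENNReal.toReal_sub_of_le (measure_mono hAB) hΛ]
  have hadd : ∀ ω, (N ω ∩ B).encard = (N ω ∩ A).encard + (N ω ∩ (B \ A)).encard := by
    intro ω
    rw [← encard_union_eq, ← inter_union_distrib_left, union_sdiff_cancel hAB]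
    exact disjoint_sdiff_right.mono inter_subset_right inter_subset_right
  have hset : {ω | ((n + 1 : ℕ) : ℕ∞) ≤ (N ω ∩ A).encard ∧
      (N ω ∩ B).encard < (n + m + 2 : ℕ)} =
      ⋃ p ∈ (Finset.range (m + 1)).sigma fun j => Finset.range (j + 1),
        {ω | (N ω ∩ A).encard = (n + 1 + p.2 : ℕ) ∧
          (N ω ∩ (B \ A)).encard = (p.1 - p.2 : ℕ)} := by
    ext ω
    simp only [mem_ofPred_eq, mem_iUnion, Finset.mem_sigma, Finset.mem_range, exists_prop,
      Sigma.exists, hadd ω]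
    constructor
    · rintro ⟨h1, h2⟩
      have h3 := h2.ne_top
      rw [ne_eq, ENat.add_eq_top, not_or] at h3
      obtain ⟨a, ha⟩ := ENat.ne_top_iff_exists.1 h3.1
      obtain ⟨b, hb⟩ := ENat.ne_top_iff_exists.1 h3.2
      rw [← ha] at h1
      rw [← ha, ← hb] at h2 ⊢
      norm_cast at h1 h2 ⊢
      exact ⟨a - (n + 1) + b, a - (n + 1), by omega, by omega, by omega⟩
    · rintro ⟨j, i, h, h1, h2⟩
      rw [h1, h2]
      norm_cast
      omega
  have hmeas : ∀ k l : ℕ, MeasurableSet {ω | (N ω ∩ A).encard = k ∧ (N ω ∩ (B \ A)).encard = l} :=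
    fun k l => (hN.measurable_count A hA (measurableSet_singleton _)).inter
      (hN.measurable_count _ hD (measurableSet_singleton _))
  rw [hset, measure_biUnion_finset _ fun i _ => hmeas _ _, Finset.sum_sigma, Finset.mul_sum,
    ENNReal.ofReal_sum_of_nonneg]
  · refine Finset.sum_congr rfl fun j _ => ?_
    rw [partialBinomial, Finset.mul_sum, ENNReal.ofReal_sum_of_nonneg]
    · refine Finset.sum_congr rfl fun i _ => ?_
      rw [hN.prob_count_eq_and_count_eq hA hD disjoint_sdiff_right hΛA hΛD,
        ← ENNReal.ofReal_mul (by positivity), ← hsub,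
        show -(Λ B).toReal = -(Λ A).toReal + -(Λ (B \ A)).toReal by rw [hsub]; ring, Real.exp_add]
      congr 1
      ring
    · intro i _
      rw [← hsub]; positivity
  · intro j _
    rw [partialBinomial, ← hsub]
    positivity
  · rintro ⟨j, i⟩ h ⟨j', i'⟩ h' hne
    refine Set.disjoint_left.2 fun ω h1 h2 => hne ?_
    simp only [mem_ofPred_eq] at h1 h2
    simp only [Finset.coe_sigma, mem_sigma_iff, Finset.mem_coe, Finset.mem_range] at h h'
    have e1 := h1.1.symm.trans h2.1
    have e2 := h1.2.symm.trans h2.2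
    norm_cast at e1 e2
    obtain rfl : i = i' := by omega
    obtain rfl : j = j' := by omega
    rfl

end Counts

end IsPoissonPointProcess

/-! ### The distances from a fixed location -/

section BallVolume

variable {M : Type*} [MetricSpace M] [MeasurableSpace M]
  {Λ : Measure M} {a : ℝ} {d : ℕ}

lemma measure_closedBall_of_nonneg (hd : 1 ≤ d)
    (hΛ : ∀ x r, 0 < r → Λ (Metric.closedBall x r) = ENNReal.ofReal (a * r ^ d))
    (x : M) {r : ℝ} (hr : 0 ≤ r) : Λ (Metric.closedBall x r) = ENNReal.ofReal (a * r ^ d) := by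
  rcases hr.eq_or_lt with rfl | hr
  · have hlim : Filter.Tendsto (fun r : ℝ => ENNReal.ofReal (a * r ^ d)) (nhdsWithin 0 (Ioi 0))
        (nhds (ENNReal.ofReal (a * 0 ^ d))) := by
      have : Continuous fun r : ℝ => ENNReal.ofReal (a * r ^ d) :=
        ENNReal.continuous_ofReal.comp (by fun_prop)
      exact this.continuousWithinAt
    have hle := ge_of_tendsto hlim (b := Λ (Metric.closedBall x 0)) (by
      filter_upwards [self_mem_nhdsWithin] with r hr
      rw [← hΛ x r hr]
      exact measure_mono (Metric.closedBall_subset_closedBall (le_of_lt hr)))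
    rw [zero_pow (by omega), mul_zero, ENNReal.ofReal_zero] at hle ⊢
    exact le_antisymm hle zero_le
  · exact hΛ x r hr

/-- The total mass is infinite, so that the process has infinitely many points. -/
lemma measure_univ_eq_top (ha : 0 < a) (hd : 1 ≤ d)
    (hΛ : ∀ x r, 0 < r → Λ (Metric.closedBall x r) = ENNReal.ofReal (a * r ^ d)) (x : M) :
    Λ univ = ∞ := by
  refine ENNReal.eq_top_of_forall_nnreal_le fun n => ?_
  have h1 : 1 ≤ max 1 (n / a) := le_max_left _ _
  refine le_trans ?_ (measure_mono (subset_univ (Metric.closedBall x (max 1 (n / a)))))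
  rw [hΛ x _ (by positivity)]
  have : (n : ℝ) ≤ a * max 1 (n / a) ^ d := by
    calc (n : ℝ) = a * (n / a) := by field_simp
      _ ≤ a * max 1 (n / a) := by gcongr; exact le_max_right _ _
      _ ≤ a * max 1 (n / a) ^ d := by gcongr; exact le_self_pow₀ h1 (by omega)
  rw [← ENNReal.ofReal_coe_nnreal]
  exact ENNReal.ofReal_le_ofReal this

end BallVolume

namespace IsPoissonPointProcess

section FixedLocation

variable {Ω M : Type*} [MeasurableSpace Ω] {P : Measure Ω} [IsProbabilityMeasure P]
  [MetricSpace M] [MeasurableSpace M] [BorelSpace M] {Λ : Measure M} {N : Ω → Set M}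
  {a : ℝ} {d : ℕ}

omit [IsProbabilityMeasure P] in
lemma ae_isInfiniteLocallyFinite (hN : IsPoissonPointProcess N Λ P) (ha : 0 < a) (hd : 1 ≤ d)
    (hΛ : ∀ x r, 0 < r → Λ (Metric.closedBall x r) = ENNReal.ofReal (a * r ^ d)) (x : M) :
    ∀ᵐ ω ∂P, IsInfiniteLocallyFinite (N ω) := by
  have hfin : ∀ n : ℕ, ∀ᵐ ω ∂P, (N ω ∩ Metric.closedBall x n).Finite := fun n =>
    hN.ae_finite Metric.isClosed_closedBall.measurableSet
      (by rw [measure_closedBall_of_nonneg hd hΛ x n.cast_nonneg]; exact ENNReal.ofReal_ne_top)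
  filter_upwards [ae_all_iff.2 hfin,
    hN.count_eq_top univ .univ (measure_univ_eq_top ha hd hΛ x)] with ω h1 h2
  rw [inter_univ, encard_eq_top_iff] at h2
  exact .of_nat h2 x h1

/-- Seen from a fixed location, the volumes of the balls reaching to the successive nearest
neighbours are the arrival times of a unit rate Poisson process. -/
lemma hasLaw_arrivalLaw (hN : IsPoissonPointProcess N Λ P) (ha : 0 < a) (hd : 1 ≤ d)
    (hΛ : ∀ x r, 0 < r → Λ (Metric.closedBall x r) = ENNReal.ofReal (a * r ^ d)) (x : M)
    (n m : ℕ) :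
    HasLaw (fun ω => (a * kthDist (N ω) x (n + 1) ^ d, a * kthDist (N ω) x (n + m + 2) ^ d))
      (arrivalLaw n m) P := by
  have hG := hN.ae_isInfiniteLocallyFinite ha hd hΛ x
  have hd0 : d ≠ 0 := by omega
  have hm : ∀ l, AEMeasurable (fun ω => a * kthDist (N ω) x l ^ d) P := fun l =>
    ((aemeasurable_kthDist hN.measurable_count hG x l).pow_const d).const_mul a
  have hpair := (hm (n + 1)).prodMk (hm (n + m + 2))
  -- the event `a * r_l ^ d ≤ s` says that the ball of intensity `s` holds at least `l` points
  have hiff : ∀ s : ℝ, 0 ≤ s → ∃ r : ℝ, 0 ≤ r ∧ a * r ^ d = s ∧ ∀ᵐ ω ∂P, ∀ l,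
      a * kthDist (N ω) x l ^ d ≤ s ↔ (l : ℕ∞) ≤ (N ω ∩ Metric.closedBall x r).encard := by
    intro s hs
    have hr : 0 ≤ (s / a) ^ (1 / d : ℝ) := by positivity
    have hrs : a * ((s / a) ^ (1 / d : ℝ)) ^ d = s := by
      rw [one_div, Real.rpow_inv_natCast_pow (by positivity) hd0]
      field_simp
    refine ⟨_, hr, hrs, ?_⟩
    filter_upwards [hG] with ω hω l
    conv_lhs => rw [← hrs, mul_le_mul_iff_right₀ ha, pow_le_pow_iff_left₀ kthDist_nonneg hr hd0]
    rw [hω.kthDist_le_iff, and_iff_right hr]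
  refine ⟨hpair, ?_⟩
  have : IsProbabilityMeasure (P.map fun ω =>
    (a * kthDist (N ω) x (n + 1) ^ d, a * kthDist (N ω) x (n + m + 2) ^ d)) :=
    Measure.isProbabilityMeasure_map hpair
  refine Measure.ext_of_Iic_prod_Ioi ?_ ?_ ?_ ?_
  · rw [ae_map_iff hpair (p := fun p : ℝ × ℝ => 0 ≤ p.1 ∧ p.1 ≤ p.2)
      ((measurableSet_le measurable_const measurable_fst).inter
      (measurableSet_le measurable_fst measurable_snd))]
    filter_upwards [hG] with ω hω
    refine ⟨mul_nonneg ha.le (pow_nonneg kthDist_nonneg _), mul_le_mul_of_nonneg_left ?_ ha.le⟩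
    exact pow_le_pow_left₀ kthDist_nonneg (kthDist_mono hω (by omega)) _
  · filter_upwards [ae_arrivalLaw n m] with p hp using ⟨hp.1.le, hp.2.le⟩
  · intro s hs
    obtain ⟨r, hr, hrs, h⟩ := hiff s hs
    have hΛr := measure_closedBall_of_nonneg hd hΛ x hr
    rw [arrivalLaw_Iic_univ n m hs, Measure.map_apply_of_aemeasurable hpair
      (measurableSet_Iic.prod .univ)]
    have hP := hN.prob_le_count (A := Metric.closedBall x r)
      Metric.isClosed_closedBall.measurableSet (by rw [hΛr]; exact ENNReal.ofReal_ne_top) (n + 1)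
    rw [hΛr, ENNReal.toReal_ofReal (by positivity), hrs] at hP
    rw [← hP]
    refine measure_congr ?_
    filter_upwards [h] with ω hω
    refine propext ⟨fun h => (hω _).1 h.1, fun h => ⟨(hω _).2 h, trivial⟩⟩
  · intro s u hs hsu
    obtain ⟨r, hr, hrs, h⟩ := hiff s hs
    obtain ⟨q, hq, hqu, h'⟩ := hiff u (hs.trans hsu)
    have hrq : r ≤ q := by
      rw [← hrs, ← hqu, mul_le_mul_iff_right₀ ha, pow_le_pow_iff_left₀ hr hq hd0] at hsu
      exact hsu
    have hΛr := measure_closedBall_of_nonneg hd hΛ x hr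
    have hΛq := measure_closedBall_of_nonneg hd hΛ x hq
    rw [arrivalLaw_Iic_Ioi n m hs hsu, Measure.map_apply_of_aemeasurable hpair
      (measurableSet_Iic.prod measurableSet_Ioi)]
    have hP := hN.prob_le_count_and_count_lt (A := Metric.closedBall x r)
      (B := Metric.closedBall x q) Metric.isClosed_closedBall.measurableSet
      Metric.isClosed_closedBall.measurableSet (Metric.closedBall_subset_closedBall hrq)
      (by rw [hΛq]; exact ENNReal.ofReal_ne_top) n m
    rw [hΛr, hΛq, ENNReal.toReal_ofReal (by positivity), ENNReal.toReal_ofReal (by positivity),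
      hrs, hqu] at hP
    rw [← hP]
    refine measure_congr ?_
    filter_upwards [h, h'] with ω hω hω'
    exact propext (and_congr (hω _) (not_le.symm.trans ((not_congr (hω' _)).trans not_le)))

end FixedLocation

end IsPoissonPointProcess

/-- The law of the distances to the `(n + 1)`-st and the `(n + m + 2)`-nd nearest neighbours when
the intensity of balls of radius `r` is `a * r ^ d`. -/
noncomputable def neighbourDistLaw (a : ℝ) (d n m : ℕ) : Measure (ℝ × ℝ) :=
  (arrivalLaw n m).map fun p => ((p.1 / a) ^ (1 / d : ℝ), (p.2 / a) ^ (1 / d : ℝ))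

instance (a : ℝ) (d n m : ℕ) : IsProbabilityMeasure (neighbourDistLaw a d n m) :=
  Measure.isProbabilityMeasure_map (by fun_prop)

section

variable {Ω M : Type*} [MeasurableSpace Ω] {P : Measure Ω} [IsProbabilityMeasure P]
  [MetricSpace M] [MeasurableSpace M] [BorelSpace M] {Λ : Measure M} {N : Ω → Set M}
  {a : ℝ} {d : ℕ}

lemma IsPoissonPointProcess.hasLaw_kthDist (hN : IsPoissonPointProcess N Λ P) (ha : 0 < a)
    (hd : 1 ≤ d)
    (hΛ : ∀ x r, 0 < r → Λ (Metric.closedBall x r) = ENNReal.ofReal (a * r ^ d)) (x : M)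
    (n m : ℕ) :
    HasLaw (fun ω => (kthDist (N ω) x (n + 1), kthDist (N ω) x (n + m + 2)))
      (neighbourDistLaw a d n m) P := by
  have hψ : Measurable fun p : ℝ × ℝ => ((p.1 / a) ^ (1 / d : ℝ), (p.2 / a) ^ (1 / d : ℝ)) := by
    fun_prop
  have h : HasLaw (fun p : ℝ × ℝ => ((p.1 / a) ^ (1 / d : ℝ), (p.2 / a) ^ (1 / d : ℝ)))
      (neighbourDistLaw a d n m) (arrivalLaw n m) := ⟨hψ.aemeasurable, rfl⟩
  have key : ∀ l ω, (a * kthDist (N ω) x l ^ d / a) ^ (1 / d : ℝ) = kthDist (N ω) x l := by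
    intro l ω
    rw [mul_div_cancel_left₀ _ ha.ne', one_div,
      Real.pow_rpow_inv_natCast kthDist_nonneg (by omega)]
  simpa only [key] using h.fun_comp (hN.hasLaw_arrivalLaw ha hd hΛ x n m)

/-- A fixed location is almost surely not a point of the process, so it makes no difference whether
it is excluded from its own neighbours. -/
lemma IsPoissonPointProcess.hasLaw_nnDist (hN : IsPoissonPointProcess N Λ P) (ha : 0 < a)
    (hd : 1 ≤ d)
    (hΛ : ∀ x r, 0 < r → Λ (Metric.closedBall x r) = ENNReal.ofReal (a * r ^ d)) (x : M)
    (n m : ℕ) :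
    HasLaw (fun ω => (nnDist (N ω) x (n + 1), nnDist (N ω) x (n + m + 2)))
      (neighbourDistLaw a d n m) P := by
  refine (hN.hasLaw_kthDist ha hd hΛ x n m).congr ?_
  have h0 : Λ {x} = 0 := by
    rw [← Metric.closedBall_zero, measure_closedBall_of_nonneg hd hΛ x le_rfl,
      zero_pow (by omega), mul_zero, ENNReal.ofReal_zero]
  filter_upwards [hN.ae_inter_eq_empty (measurableSet_singleton x) h0] with ω hω
  have : N ω \ {x} = N ω := by rwa [sdiff_eq_left, disjoint_iff_inter_eq_empty]
  simp only [nnDist_eq_kthDist, this]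

end

section RatioLaw

variable {a : ℝ} {d n m : ℕ}

lemma neighbourDistLaw_ae_pos (ha : 0 < a) (hd : 1 ≤ d) :
    ∀ᵐ p ∂neighbourDistLaw a d n m, 0 < p.1 ∧ p.1 < p.2 := by
  rw [neighbourDistLaw, ae_map_iff (by fun_prop) (p := fun p : ℝ × ℝ => 0 < p.1 ∧ p.1 < p.2)
    ((measurableSet_lt measurable_const measurable_fst).inter
      (measurableSet_lt measurable_fst measurable_snd))]
  filter_upwards [ae_arrivalLaw n m] with p hp
  have h1 := hp.1
  exact ⟨by positivity, Real.rpow_lt_rpow (by positivity)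
    (div_lt_div_of_pos_right hp.2 ha) (by positivity)⟩

lemma hasLaw_ratio_pow_sub_one (ha : 0 < a) (hd : 1 ≤ d) :
    HasLaw (fun p : ℝ × ℝ => (p.2 / p.1) ^ d - 1) (betaPrimeLaw (m + 1) (n + 1))
      (neighbourDistLaw a d n m) := by
  refine ⟨by fun_prop, ?_⟩
  rw [neighbourDistLaw, Measure.map_map (by fun_prop) (by fun_prop),
    ← map_div_sub_one_arrivalLaw]
  refine Measure.map_congr ?_
  filter_upwards [ae_arrivalLaw n m] with p hp
  have h1 := hp.1
  have h2 := h1.trans hp.2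
  have hd0 : d ≠ 0 := by omega
  simp only [Function.comp]
  rw [div_pow, one_div, Real.rpow_inv_natCast_pow (by positivity) hd0,
    Real.rpow_inv_natCast_pow (by positivity) hd0]
  field_simp

lemma hasLaw_ratio (ha : 0 < a) (hd : 1 ≤ d) :
    HasLaw (fun p : ℝ × ℝ => p.2 / p.1) (nnRatioLaw d (n + 1) (n + m + 2))
      (neighbourDistLaw a d n m) := by
  have h := map_betaPrimeLaw hd (n₁ := n + 1) (n₂ := n + m + 2) (by omega) (by omega)
  rw [show ((n + m + 2 : ℕ) : ℝ) - (n + 1 : ℕ) = m + 1 by push_cast; ring,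
    show ((n + 1 : ℕ) : ℝ) = n + 1 by push_cast; ring] at h
  refine (HasLaw.fun_comp ⟨by fun_prop, h⟩ (hasLaw_ratio_pow_sub_one ha hd)).congr ?_
  filter_upwards [neighbourDistLaw_ae_pos ha hd] with p hp
  have h1 := hp.1
  have h2 := h1.trans hp.2
  rw [add_sub_cancel, one_div, Real.pow_rpow_inv_natCast (by positivity) (by omega)]

lemma lintegral_ratio_rpow (ha : 0 < a) (hd : 1 ≤ d) {k : ℝ} (hk : k < d * (n + 1)) :
    ∫⁻ p, ENNReal.ofReal ((p.2 / p.1) ^ k) ∂neighbourDistLaw a d n m =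
      ENNReal.ofReal (beta (m + 1) (n + 1 - k / d) / beta (m + 1) (n + 1)) := by
  have hd0 : (0 : ℝ) < d := by positivity
  rw [← lintegral_rpow_betaPrimeLaw (by positivity) (by positivity) (by rwa [div_lt_iff₀' hd0]),
    ← (hasLaw_ratio_pow_sub_one ha hd).lintegral_comp (f := fun z =>
      ENNReal.ofReal ((1 + z) ^ (k / d))) (by fun_prop)]
  refine lintegral_congr_ae ?_
  filter_upwards [neighbourDistLaw_ae_pos ha hd] with p hp
  have h1 := hp.1
  have h2 := h1.trans hp.2
  rw [add_sub_cancel, ← Real.rpow_natCast, ← Real.rpow_mul (by positivity),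
    mul_div_cancel₀ _ hd0.ne']

end RatioLaw

/-! ### First and second order estimates, and independence of the exterior -/

namespace IsPoissonPointProcess

section Counts

variable {Ω M : Type*} [MeasurableSpace Ω] {P : Measure Ω}
  [MeasurableSpace M] {Λ : Measure M} {N : Ω → Set M} {A B C : Set M}

lemma measurable_toENNReal_count (hN : IsPoissonPointProcess N Λ P) (hA : MeasurableSet A) :
    Measurable fun ω => ((N ω ∩ A).encard : ℝ≥0∞) :=
  (Measurable.of_discrete (f := fun n : ℕ∞ => (n : ℝ≥0∞))).comp (hN.measurable_count A hA)

/-- Campbell's formula for the mean number of points. -/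
lemma lintegral_count (hN : IsPoissonPointProcess N Λ P) (hA : MeasurableSet A) (hΛ : Λ A ≠ ∞) :
    ∫⁻ ω, ((N ω ∩ A).encard : ℝ≥0∞) ∂P = Λ A := by
  rw [(hN.law_count A hA hΛ).lintegral_comp (f := fun n : ℕ∞ => (n : ℝ≥0∞))
    Measurable.of_discrete.aemeasurable, lintegral_map .of_discrete .of_discrete,
    lintegral_countable']
  set r := (Λ A).toNNReal with hr
  have hmass : ∑' n, poissonMeasure r {n} = 1 := by
    have := lintegral_countable' (μ := poissonMeasure r) fun _ => 1
    simpa using this.symm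
  rw [tsum_eq_zero_add' ENNReal.summable]
  have hstep : ∀ n : ℕ, (((n + 1 : ℕ) : ℕ∞) : ℝ≥0∞) * poissonMeasure r {n + 1} =
      Λ A * poissonMeasure r {n} := by
    intro n
    rw [← ENNReal.coe_toNNReal hΛ, ← hr, poissonMeasure_singleton, poissonMeasure_singleton,
      ← ENNReal.ofReal_coe_nnreal, ← ENNReal.ofReal_mul (by positivity), ENat.toENNReal_coe,
      ← ENNReal.ofReal_natCast, ← ENNReal.ofReal_mul (by positivity)]
    congr 1
    rw [Nat.factorial_succ]
    push_cast
    field_simp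
    ring
  simp_rw [hstep]
  rw [ENNReal.tsum_mul_left, hmass]
  simp

/-- The mean of the number of points in `A`, restricted to the event that there are several, is
of second order in the intensity of `A`. -/
lemma lintegral_count_of_ne_one_le (hN : IsPoissonPointProcess N Λ P) (hA : MeasurableSet A)
    (hΛ : Λ A ≠ ∞) :
    ∫⁻ ω, (if (N ω ∩ A).encard = 1 then 0 else ((N ω ∩ A).encard : ℝ≥0∞)) ∂P ≤ Λ A * Λ A := by
  have hm : Measurable fun ω => if (N ω ∩ A).encard = 1 then 0 else ((N ω ∩ A).encard : ℝ≥0∞) :=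
    (Measurable.of_discrete (f := fun n : ℕ∞ => if n = 1 then 0 else (n : ℝ≥0∞))).comp
      (hN.measurable_count A hA)
  have h1 : MeasurableSet {ω | (N ω ∩ A).encard = 1} :=
    hN.measurable_count A hA (measurableSet_singleton 1)
  have hsplit : ∫⁻ ω, (if (N ω ∩ A).encard = 1 then 0 else ((N ω ∩ A).encard : ℝ≥0∞)) ∂P +
      P {ω | (N ω ∩ A).encard = 1} = Λ A := by
    rw [← lintegral_indicator_one h1, ← lintegral_add_left hm, ← hN.lintegral_count hA hΛ]
    refine lintegral_congr fun ω => ?_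
    by_cases h : (N ω ∩ A).encard = 1 <;> simp [h]
  have hP : P {ω | (N ω ∩ A).encard = 1} =
      ENNReal.ofReal (Real.exp (-(Λ A).toReal) * (Λ A).toReal) := by
    simpa using hN.prob_count_eq hA hΛ 1
  set l := (Λ A).toReal with hl
  have hl0 : 0 ≤ l := ENNReal.toReal_nonneg
  have hΛl : Λ A = ENNReal.ofReal l := (ENNReal.ofReal_toReal hΛ).symm
  rw [ENNReal.eq_sub_of_add_eq (by rw [hP]; exact ENNReal.ofReal_ne_top) hsplit, hP, hΛl,
    ← ENNReal.ofReal_mul hl0, ← ENNReal.ofReal_sub _ (by positivity)]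
  refine ENNReal.ofReal_le_ofReal ?_
  nlinarith [Real.add_one_le_exp (-l)]

/-- The sets `A` and `B` may overlap: the counts are recovered from those in `A ∩ B`, `A \ B` and
`B \ A`. -/
lemma indepFun_count_prodMk (hN : IsPoissonPointProcess N Λ P) (hC : MeasurableSet C)
    (hA : MeasurableSet A) (hB : MeasurableSet B) (hCA : Disjoint C A) (hCB : Disjoint C B) :
    IndepFun (fun ω => (N ω ∩ C).encard)
      (fun ω => ((N ω ∩ A).encard, (N ω ∩ B).encard)) P := by
  let D : Fin 4 → Set M := ![C, A ∩ B, A \ B, B \ A]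
  have hD : ∀ j, MeasurableSet (D j) := by
    intro j
    fin_cases j
    exacts [hC, hA.inter hB, hA.diff hB, hB.diff hA]
  have hdisj : Pairwise fun i j => Disjoint (D i) (D j) := by
    have h01 : Disjoint C (A ∩ B) := hCA.mono_right inter_subset_left
    have h02 : Disjoint C (A \ B) := hCA.mono_right sdiff_subset
    have h03 : Disjoint C (B \ A) := hCB.mono_right sdiff_subset
    have h12 : Disjoint (A ∩ B) (A \ B) := disjoint_sdiff_right.mono_left inter_subset_right
    have h13 : Disjoint (A ∩ B) (B \ A) := disjoint_sdiff_right.mono_left inter_subset_left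
    have h23 : Disjoint (A \ B) (B \ A) := disjoint_sdiff_right.mono_left sdiff_subset
    intro i j hij
    fin_cases i <;> fin_cases j <;> first
      | exact absurd rfl hij
      | assumption
      | (apply Disjoint.symm; assumption)
  have hind := (hN.indep_count 4 D hD hdisj).indepFun_finset {0} {1, 2, 3} (by simp)
    fun j => hN.measurable_count _ (hD j)
  let u : (({0} : Finset (Fin 4)) → ℕ∞) → ℕ∞ := fun f => f ⟨0, by simp⟩
  let v : (({1, 2, 3} : Finset (Fin 4)) → ℕ∞) → ℕ∞ × ℕ∞ := fun f =>
    (f ⟨1, by simp⟩ + f ⟨2, by simp⟩, f ⟨1, by simp⟩ + f ⟨3, by simp⟩)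
  have hadd : ∀ {A B : Set M} (S : Set M),
      (S ∩ (A ∩ B)).encard + (S ∩ (A \ B)).encard = (S ∩ A).encard := by
    intro A B S
    rw [← encard_union_eq, ← inter_union_distrib_left, inter_union_sdiff]
    exact (disjoint_sdiff_right.mono_left inter_subset_right).mono inter_subset_right
      inter_subset_right
  have hu : Measurable u := measurable_pi_apply _
  have hv : Measurable v := by
    refine Measurable.prodMk ?_ ?_ <;>
      exact Measurable.add (measurable_pi_apply _) (measurable_pi_apply _)
  have hcomp := hind.comp hu hv
  have hAB : (fun ω => ((N ω ∩ A).encard, (N ω ∩ B).encard)) =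
      v ∘ fun ω i => (N ω ∩ D i).encard := by
    funext ω
    refine Prod.ext (hadd (N ω)).symm ?_
    show _ = (N ω ∩ (A ∩ B)).encard + (N ω ∩ (B \ A)).encard
    rw [inter_comm A B]
    exact (hadd (N ω)).symm
  rw [hAB]
  exact hcomp

lemma measurable_count_diff (hN : IsPoissonPointProcess N Λ P) (hC : MeasurableSet C)
    (A : Set M) (hA : MeasurableSet A) : Measurable fun ω => ((N ω \ C) ∩ A).encard := by
  have : ∀ ω, (N ω \ C) ∩ A = N ω ∩ (A \ C) := fun ω => by
    ext; simp only [mem_inter_iff, mem_sdiff]; tauto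
  simp_rw [this]
  exact hN.measurable_count _ (hA.diff hC)

end Counts

section Palm

variable {Ω M : Type*} [MeasurableSpace Ω] {P : Measure Ω} [IsProbabilityMeasure P]
  [MetricSpace M] [MeasurableSpace M] [BorelSpace M] {Λ : Measure M} {N : Ω → Set M}
  {A C : Set M} {n₁ n₂ : ℕ}

omit [IsProbabilityMeasure P] [BorelSpace M] in
lemma ae_isInfiniteLocallyFinite_diff (hN : IsPoissonPointProcess N Λ P)
    (hG : ∀ᵐ ω ∂P, IsInfiniteLocallyFinite (N ω)) (hC : MeasurableSet C) (hΛC : Λ C ≠ ∞) :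
    ∀ᵐ ω ∂P, IsInfiniteLocallyFinite (N ω \ C) := by
  filter_upwards [hG, hN.ae_finite hC hΛC] with ω h1 h2 using h1.diff h2

/-- The number of points in `C` is independent of the nearest neighbour distances among the points
outside of `C`. -/
lemma indepFun_count_kthDist (hN : IsPoissonPointProcess N Λ P)
    (hG : ∀ᵐ ω ∂P, IsInfiniteLocallyFinite (N ω)) (hC : MeasurableSet C) (hΛC : Λ C ≠ ∞) (y : M) :
    IndepFun (fun ω => (N ω ∩ C).encard)
      (fun ω => (kthDist (N ω \ C) y n₁, kthDist (N ω \ C) y n₂)) P := by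
  have hGC := hN.ae_isInfiniteLocallyFinite_diff hG hC hΛC
  have hk := hN.measurable_count C hC
  have hW : AEMeasurable (fun ω => (kthDist (N ω \ C) y n₁, kthDist (N ω \ C) y n₂)) P :=
    (aemeasurable_kthDist (hN.measurable_count_diff hC) hGC y n₁).prodMk
      (aemeasurable_kthDist (hN.measurable_count_diff hC) hGC y n₂)
  rw [indepFun_iff_map_prod_eq_prod_map_map hk.aemeasurable hW]
  refine Measure.ext_prod fun {s t} hs ht => ?_
  have hmeas : MeasurableSet {ω | (N ω ∩ C).encard ∈ s} := hk hs
  rw [Measure.map_apply_of_aemeasurable (hk.aemeasurable.prodMk hW) (hs.prod ht),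
    Measure.prod_prod, Measure.map_apply hk hs]
  -- on rectangles `Iic r ×ˢ Iic q` the distances are expressed by the counts in `closedBall \ C`
  have key : (P.restrict {ω | (N ω ∩ C).encard ∈ s}).map
      (fun ω => (kthDist (N ω \ C) y n₁, kthDist (N ω \ C) y n₂)) =
      P {ω | (N ω ∩ C).encard ∈ s} •
        P.map fun ω => (kthDist (N ω \ C) y n₁, kthDist (N ω \ C) y n₂) := by
    refine Measure.ext_of_Iic_prod_Iic (fun r q => ?_) ?_
    · have hI : MeasurableSet (Iic r ×ˢ Iic q) := measurableSet_Iic.prod measurableSet_Iic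
      rw [Measure.map_apply_of_aemeasurable hW.restrict hI, Measure.smul_apply,
        Measure.map_apply_of_aemeasurable hW hI, Measure.restrict_apply' hmeas, smul_eq_mul]
      by_cases hrq : 0 ≤ r ∧ 0 ≤ q
      · have hdis : ∀ r, Disjoint C (Metric.closedBall y r \ C) := fun r => disjoint_sdiff_right
        have hmb : ∀ r, MeasurableSet (Metric.closedBall y r \ C) := fun r =>
          Metric.isClosed_closedBall.measurableSet.diff hC
        have hind := (hN.indepFun_count_prodMk hC (hmb r) (hmb q) (hdis r)
          (hdis q)).measure_inter_preimage_eq_mul s (Ici (n₁ : ℕ∞) ×ˢ Ici (n₂ : ℕ∞)) hs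
          .of_discrete
        have hev : (fun ω => (kthDist (N ω \ C) y n₁, kthDist (N ω \ C) y n₂)) ⁻¹'
            (Iic r ×ˢ Iic q) =ᵐ[P] (fun ω => ((N ω ∩ (Metric.closedBall y r \ C)).encard,
              (N ω ∩ (Metric.closedBall y q \ C)).encard)) ⁻¹'
                (Ici (n₁ : ℕ∞) ×ˢ Ici (n₂ : ℕ∞)) := by
          filter_upwards [hGC] with ω hω
          have e : ∀ r, (N ω \ C) ∩ Metric.closedBall y r = N ω ∩ (Metric.closedBall y r \ C) :=
            fun r => by ext; simp only [mem_inter_iff, mem_sdiff]; tauto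
          refine propext (and_congr ?_ ?_)
          · exact hω.kthDist_le_iff.trans ((and_iff_right hrq.1).trans (by rw [e]; rfl))
          · exact hω.kthDist_le_iff.trans ((and_iff_right hrq.2).trans (by rw [e]; rfl))
        rw [measure_congr hev, inter_comm]
        rw [measure_congr ((Filter.EventuallyEq.refl _ _).inter hev)]
        exact hind
      · have hempty : (fun ω => (kthDist (N ω \ C) y n₁, kthDist (N ω \ C) y n₂)) ⁻¹'
            (Iic r ×ˢ Iic q) = ∅ := by
          refine eq_empty_of_forall_notMem fun ω h => hrq ?_
          exact ⟨kthDist_nonneg.trans h.1, kthDist_nonneg.trans h.2⟩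
        rw [hempty]
        simp
    · rw [Measure.map_apply_of_aemeasurable hW.restrict .univ, Measure.smul_apply,
        Measure.map_apply_of_aemeasurable hW .univ]
      simp
  have := congrArg (fun μ => μ t) key
  simp only [Measure.smul_apply, smul_eq_mul] at this
  rw [Measure.map_apply_of_aemeasurable hW.restrict ht, Measure.restrict_apply' hmeas] at this
  rw [show (fun ω => (N ω ∩ C).encard) ⁻¹' s = {ω | (N ω ∩ C).encard ∈ s} from rfl, ← this,
    inter_comm]
  rfl

end Palm

end IsPoissonPointProcess

/-! ### The Campbell measure and its estimate on small cells -/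

namespace IsPoissonPointProcess

section CountingKernel

variable {Ω M : Type*} [MeasurableSpace Ω] {P : Measure Ω}
  [MeasurableSpace M] [MeasurableSingletonClass M] {Λ : Measure M} {N : Ω → Set M} {A : Set M}

/-- The counting measure of the points in a window of finite intensity is almost surely given by
an s-finite kernel. -/
lemma exists_kernel (hN : IsPoissonPointProcess N Λ P) (hA : MeasurableSet A) (hΛ : Λ A ≠ ∞) :
    ∃ κ : Kernel Ω M, IsSFiniteKernel κ ∧
      ∀ᵐ ω ∂P, κ ω = Measure.count.restrict (N ω ∩ A) := by
  have hNm : ∀ ω, MeasurableSet (N ω) := fun ω => (hN.countable ω).measurableSet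
  have happ : ∀ ω s, MeasurableSet s →
      Measure.count.restrict (N ω ∩ A) s = ((N ω ∩ (A ∩ s)).encard : ℝ≥0∞) := by
    intro ω s hs
    rw [Measure.restrict_apply hs, Measure.count_apply (hs.inter ((hNm ω).inter hA))]
    congr 2
    ext; simp only [mem_inter_iff]; tauto
  let κ₀ : Kernel Ω M := ⟨fun ω => Measure.count.restrict (N ω ∩ A),
    Measure.measurable_of_measurable_coe _ fun s hs => by
      simp_rw [happ _ s hs]
      exact hN.measurable_toENNReal_count (hA.inter hs)⟩
  have hs : ∀ n : ℕ, MeasurableSet {ω | (N ω ∩ A).encard = n} := fun n =>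
    hN.measurable_count A hA (measurableSet_singleton _)
  classical
  -- s-finiteness has to be uniform in `ω`: split according to the number of points
  let κ : ℕ → Kernel Ω M := fun n => Kernel.piecewise (hs n) κ₀ 0
  have hκ : ∀ n ω, κ n ω = if (N ω ∩ A).encard = n then κ₀ ω else 0 := fun n ω => by
    rw [Kernel.piecewise_apply]; rfl
  have hfin : ∀ n, IsFiniteKernel (κ n) := fun n => by
    refine ⟨⟨n, by simp, fun ω => ?_⟩⟩
    rw [hκ]
    split_ifs with h
    · show Measure.count.restrict (N ω ∩ A) univ ≤ n
      rw [happ ω univ .univ, inter_univ, h]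
      simp
    · simp
  refine ⟨Kernel.sum κ, inferInstance, ?_⟩
  filter_upwards [hN.ae_finite hA hΛ] with ω hω
  obtain ⟨n, hn⟩ := ENat.ne_top_iff_exists.1 (encard_ne_top_iff.2 hω)
  ext s hs
  rw [Kernel.sum_apply' _ _ hs, tsum_eq_single n]
  · rw [hκ, if_pos hn.symm]; rfl
  · intro m hm
    rw [hκ, if_neg, Measure.coe_zero, Pi.zero_apply]
    rw [← hn]
    exact_mod_cast hm.symm

end CountingKernel

section Palm

variable {Ω M : Type*} [MeasurableSpace Ω] {P : Measure Ω} [IsProbabilityMeasure P]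
  [MetricSpace M] [MeasurableSpace M] [BorelSpace M] {Λ : Measure M} {N : Ω → Set M}
  {A C : Set M} {n₁ n₂ : ℕ} {ν : Measure (ℝ × ℝ)}

omit [IsProbabilityMeasure P] in
/-- The distances from the points of the process to their nearest neighbours depend on the
realization and on the point in a jointly measurable way. For a point `x` of the process the `l`-th
neighbour other than `x` is the `(l + 1)`-st point counted from `x`; the latter is at a distance
which is continuous in `x`. -/
lemma exists_measurable_nnDist [SecondCountableTopology M]
    (hN : IsPoissonPointProcess N Λ P)
    (hG : ∀ᵐ ω ∂P, IsInfiniteLocallyFinite (N ω)) (l : ℕ) :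
    ∃ f : Ω × M → ℝ, Measurable f ∧ ∀ᵐ ω ∂P, ∀ x ∈ N ω, f (ω, x) = nnDist (N ω) x l := by
  let u : M → Ω → ℝ := fun x =>
    {ω | IsInfiniteLocallyFinite (N ω)}.indicator fun ω => kthDist (N ω) x (l + 1)
  have hu : Measurable (Function.uncurry u) := by
    refine measurable_uncurry_of_continuous_of_measurable (fun ω => ?_) fun x =>
      measurable_indicator_kthDist hN.measurable_count x _
    by_cases h : IsInfiniteLocallyFinite (N ω)
    · simpa [u, h] using (h.lipschitzWith_kthDist (l + 1)).continuous
    · simpa [u, h] using continuous_const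
  refine ⟨fun p => u p.2 p.1, hu.comp measurable_swap, ?_⟩
  filter_upwards [hG] with ω hω x hx
  rw [nnDist_eq_kthDist, kthDist_diff_singleton hx]
  exact indicator_of_mem (s := {ω | IsInfiniteLocallyFinite (N ω)}) hω _

omit [IsProbabilityMeasure P] in
/-- The Campbell measure of the process in the window `A`, transported to the pair of nearest
neighbour distances. -/
lemma exists_campbell [SFinite P] [SecondCountableTopology M]
    (hN : IsPoissonPointProcess N Λ P)
    (hG : ∀ᵐ ω ∂P, IsInfiniteLocallyFinite (N ω)) (hA : MeasurableSet A) (hΛ : Λ A ≠ ∞) :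
    ∃ μ : Measure (ℝ × ℝ), ∀ F : ℝ × ℝ → ℝ≥0∞, Measurable F →
      AEMeasurable (fun ω => ∫⁻ x in N ω ∩ A,
        F (nnDist (N ω) x n₁, nnDist (N ω) x n₂) ∂Measure.count) P ∧
      ∫⁻ p, F p ∂μ = ∫⁻ ω, ∫⁻ x in N ω ∩ A,
        F (nnDist (N ω) x n₁, nnDist (N ω) x n₂) ∂Measure.count ∂P := by
  obtain ⟨κ, hκ, hκN⟩ := hN.exists_kernel hA hΛ
  obtain ⟨f₁, hf₁, hfN₁⟩ := hN.exists_measurable_nnDist hG n₁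
  obtain ⟨f₂, hf₂, hfN₂⟩ := hN.exists_measurable_nnDist hG n₂
  refine ⟨(P ⊗ₘ κ).map fun p => (f₁ p, f₂ p), fun F hF => ?_⟩
  have hFf : Measurable fun p : Ω × M => F (f₁ p, f₂ p) := hF.comp (hf₁.prodMk hf₂)
  have hae : (fun ω => ∫⁻ x, F (f₁ (ω, x), f₂ (ω, x)) ∂κ ω) =ᵐ[P] fun ω =>
      ∫⁻ x in N ω ∩ A, F (nnDist (N ω) x n₁, nnDist (N ω) x n₂) ∂Measure.count := by
    filter_upwards [hκN, hfN₁, hfN₂] with ω h h₁ h₂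
    rw [h]
    refine setLIntegral_congr_fun ((hN.countable ω).measurableSet.inter hA) fun x hx => ?_
    simp only [h₁ x hx.1, h₂ x hx.1]
  refine ⟨⟨_, hFf.lintegral_kernel_prod_right', hae.symm⟩, ?_⟩
  rw [lintegral_map hF (hf₁.prodMk hf₂), Measure.lintegral_compProd hFf, lintegral_congr_ae hae]

/-- If `C` is contained in a small ball around `y`, then up to an error of second order each point
of the process in `C` sees the same distances as `y` sees among the points outside of `C`, and
these are independent of the number of points in `C`. -/
lemma campbell_cell_bounds (hN : IsPoissonPointProcess N Λ P)
    (hG : ∀ᵐ ω ∂P, IsInfiniteLocallyFinite (N ω)) {y : M}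
    (hlaw : HasLaw (fun ω => (kthDist (N ω) y n₁, kthDist (N ω) y n₂)) ν P)
    (hC : MeasurableSet C) (hΛ : Λ C ≠ ∞) {ε : ℝ}
    (hCy : C ⊆ Metric.closedBall y ε) {K : ℝ≥0} {F : ℝ × ℝ → ℝ≥0} (hF : LipschitzWith K F)
    (hF1 : ∀ p, F p ≤ 1) :
    (∫⁻ ω, ∫⁻ x in N ω ∩ C, F (nnDist (N ω) x n₁, nnDist (N ω) x n₂) ∂Measure.count ∂P ≤
      Λ C * (∫⁻ p, F p ∂ν + (K * ENNReal.ofReal ε + 2 * Λ C))) ∧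
    (Λ C * ∫⁻ p, F p ∂ν ≤
      ∫⁻ ω, ∫⁻ x in N ω ∩ C, F (nnDist (N ω) x n₁, nnDist (N ω) x n₂) ∂Measure.count ∂P +
      Λ C * (K * ENNReal.ofReal ε + 2 * Λ C)) := by
  -- `k` is the number of points in `C`, `e` the error made unless there is exactly one of them,
  -- `S` the sum of `F` over them, and `Y` the value of `F` seen from `y` outside of `C`
  let k : Ω → ℝ≥0∞ := fun ω => ((N ω ∩ C).encard : ℝ≥0∞)
  let e : Ω → ℝ≥0∞ := fun ω => if (N ω ∩ C).encard = 1 then 0 else ((N ω ∩ C).encard : ℝ≥0∞)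
  let S : Ω → ℝ≥0∞ := fun ω =>
    ∫⁻ x in N ω ∩ C, F (nnDist (N ω) x n₁, nnDist (N ω) x n₂) ∂Measure.count
  let Y : Ω → ℝ≥0∞ := fun ω => F (kthDist (N ω \ C) y n₁, kthDist (N ω \ C) y n₂)
  have hFm : Measurable fun p => (F p : ℝ≥0∞) := hF.continuous.measurable.coe_nnreal_ennreal
  have hk : Measurable k := hN.measurable_toENNReal_count hC
  have he : Measurable e :=
    (Measurable.of_discrete (f := fun n : ℕ∞ => if n = 1 then 0 else (n : ℝ≥0∞))).comp
      (hN.measurable_count C hC)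
  have hGC := hN.ae_isInfiniteLocallyFinite_diff hG hC hΛ
  have hW : AEMeasurable (fun ω => (kthDist (N ω \ C) y n₁, kthDist (N ω \ C) y n₂)) P :=
    (aemeasurable_kthDist (hN.measurable_count_diff hC) hGC y n₁).prodMk
      (aemeasurable_kthDist (hN.measurable_count_diff hC) hGC y n₂)
  have hY : AEMeasurable Y P := hFm.comp_aemeasurable hW
  have hEk : ∫⁻ ω, k ω ∂P = Λ C := hN.lintegral_count hC hΛ
  have hEe : ∫⁻ ω, e ω ∂P ≤ Λ C * Λ C := hN.lintegral_count_of_ne_one_le hC hΛ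
  have hEkY : ∫⁻ ω, k ω * Y ω ∂P = Λ C * ∫⁻ ω, Y ω ∂P := by
    have hind := (hN.indepFun_count_kthDist (n₁ := n₁) (n₂ := n₂) hG hC hΛ y).comp
      (Measurable.of_discrete (f := fun n : ℕ∞ => (n : ℝ≥0∞))) hFm
    have := lintegral_mul_eq_lintegral_mul_lintegral_of_indepFun'' (f := k) (g := Y)
      hk.aemeasurable hY hind
    rw [this, hEk]
  have hEI : ∫⁻ ω, F (kthDist (N ω) y n₁, kthDist (N ω) y n₂) ∂P = ∫⁻ p, F p ∂ν :=
    hlaw.lintegral_comp (f := fun p => (F p : ℝ≥0∞)) hFm.aemeasurable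
  have hk1 : ∀ ω, k ω = 0 ∧ N ω \ C = N ω ∨ 1 ≤ k ω := by
    intro ω
    by_cases h : N ω ∩ C = ∅
    · exact Or.inl ⟨by simp [k, h], by rwa [sdiff_eq_left, disjoint_iff_inter_eq_empty]⟩
    · right
      have : 1 ≤ (N ω ∩ C).encard := one_le_encard_iff_nonempty.2 (nonempty_iff_ne_empty.2 h)
      exact ENat.toENNReal_one.symm.le.trans (ENat.toENNReal_le.2 this)
  have hF1' : ∀ p, (F p : ℝ≥0∞) ≤ 1 := fun p => by exact_mod_cast hF1 p
  have hYI : ∫⁻ ω, Y ω ∂P ≤ ∫⁻ p, F p ∂ν + Λ C := by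
    rw [← hEI, ← hEk, ← lintegral_add_right _ hk]
    refine lintegral_mono fun ω => ?_
    rcases hk1 ω with ⟨h0, hd⟩ | h1
    · simp only [Y, hd]; exact le_self_add
    · exact (hF1' _).trans (h1.trans le_add_self)
  have hIY : ∫⁻ p, F p ∂ν ≤ ∫⁻ ω, Y ω ∂P + Λ C := by
    rw [← hEI, ← hEk, ← lintegral_add_right _ hk]
    refine lintegral_mono fun ω => ?_
    rcases hk1 ω with ⟨h0, hd⟩ | h1
    · simp only [Y, hd]; exact le_self_add
    · exact (hF1' _).trans (h1.trans le_add_self)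
  -- the pointwise comparison of the sum over `N ω ∩ C` with `k ω * Y ω`
  have hpt : ∀ᵐ ω ∂P, S ω ≤ k ω * Y ω + (K * ENNReal.ofReal ε * k ω + e ω) ∧
      k ω * Y ω ≤ S ω + (K * ENNReal.ofReal ε * k ω + e ω) := by
    filter_upwards [hGC] with ω hω
    by_cases h1 : (N ω ∩ C).encard = 1
    -- the only point `x` of the process in `C` has the points outside of `C` as neighbours
    · obtain ⟨x, hx⟩ := encard_eq_one.1 h1
      have hxm : x ∈ N ω ∩ C := hx ▸ mem_singleton x
      have hdiff : N ω \ {x} = N ω \ C := by rw [← hx, sdiff_self_inter]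
      have hS : S ω = F (kthDist (N ω \ C) x n₁, kthDist (N ω \ C) x n₂) := by
        simp only [S, hx, nnDist_eq_kthDist]
        rw [Measure.restrict_singleton]
        simp [hdiff]
      have hk' : k ω = 1 := by simp [k, h1]
      have hd : edist x y ≤ ENNReal.ofReal ε := by
        rw [edist_dist]; exact ENNReal.ofReal_le_ofReal (hCy hxm.2)
      have hdist : edist (kthDist (N ω \ C) x n₁, kthDist (N ω \ C) x n₂)
          (kthDist (N ω \ C) y n₁, kthDist (N ω \ C) y n₂) ≤ ENNReal.ofReal ε := by
        rw [Prod.edist_eq]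
        refine max_le ?_ ?_
        · exact le_trans (by simpa using hω.lipschitzWith_kthDist n₁ x y) hd
        · exact le_trans (by simpa using hω.lipschitzWith_kthDist n₂ x y) hd
      have hFd := (hF (kthDist (N ω \ C) x n₁, kthDist (N ω \ C) x n₂)
          (kthDist (N ω \ C) y n₁, kthDist (N ω \ C) y n₂)).trans
        (mul_le_mul_right hdist (K : ℝ≥0∞))
      have hle : ∀ a b : ℝ≥0, (a : ℝ≥0∞) ≤ b + edist a b := by
        intro a b
        rw [edist_nndist]
        norm_cast
        rw [NNReal.nndist_eq]
        exact tsub_le_iff_left.1 (le_max_left _ _)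
      rw [hS, hk', one_mul, mul_one]
      constructor
      · exact (hle _ (F (kthDist (N ω \ C) y n₁, kthDist (N ω \ C) y n₂))).trans
          (add_le_add le_rfl (hFd.trans le_self_add))
      · refine (hle _ (F (kthDist (N ω \ C) x n₁, kthDist (N ω \ C) x n₂))).trans
          (add_le_add le_rfl ?_)
        rw [edist_comm]
        exact hFd.trans le_self_add
    · have hek : e ω = k ω := by simp [e, k, h1]
      have hSk : S ω ≤ k ω := by
        calc S ω ≤ ∫⁻ x in N ω ∩ C, 1 ∂Measure.count := lintegral_mono fun x => hF1' _
          _ = k ω := by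
            rw [setLIntegral_one, Measure.count_apply ((hN.countable ω).measurableSet.inter hC)]
      have hYk : k ω * Y ω ≤ k ω := mul_le_of_le_one_right' (hF1' _)
      rw [hek]
      exact ⟨hSk.trans (le_add_self.trans le_add_self), hYk.trans (le_add_self.trans le_add_self)⟩
  have hEerr : ∫⁻ ω, (K * ENNReal.ofReal ε * k ω + e ω) ∂P ≤
      Λ C * (K * ENNReal.ofReal ε) + Λ C * Λ C := by
    rw [lintegral_add_right _ he, lintegral_const_mul _ hk, hEk, mul_comm (Λ C)]
    gcongr
  have herr : Measurable fun ω => K * ENNReal.ofReal ε * k ω + e ω := (hk.const_mul _).add he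
  constructor
  · calc ∫⁻ ω, S ω ∂P ≤ ∫⁻ ω, (k ω * Y ω + (K * ENNReal.ofReal ε * k ω + e ω)) ∂P :=
          lintegral_mono_ae (hpt.mono fun ω h => h.1)
      _ ≤ Λ C * (∫⁻ p, F p ∂ν + Λ C) + (Λ C * (K * ENNReal.ofReal ε) + Λ C * Λ C) := by
          rw [lintegral_add_right _ herr, hEkY]
          gcongr
      _ = _ := by ring
  · calc Λ C * ∫⁻ p, F p ∂ν ≤ Λ C * (∫⁻ ω, Y ω ∂P + Λ C) := by gcongr
      _ = ∫⁻ ω, k ω * Y ω ∂P + Λ C * Λ C := by rw [hEkY, mul_add]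
      _ ≤ ∫⁻ ω, (S ω + (K * ENNReal.ofReal ε * k ω + e ω)) ∂P + Λ C * Λ C := by
          gcongr 1
          exact lintegral_mono_ae (hpt.mono fun ω h => h.2)
      _ ≤ ∫⁻ ω, S ω ∂P + (Λ C * (K * ENNReal.ofReal ε) + Λ C * Λ C) + Λ C * Λ C := by
          rw [lintegral_add_right _ herr]
          gcongr
      _ = _ := by ring

end Palm

end IsPoissonPointProcess

/-! ### The Palm distribution of the distances -/

/-- Finite Borel measures are determined by their integrals over Lipschitz functions with values in
`[0, 1]`, since the indicators of closed sets are limits of such functions. -/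
lemma MeasureTheory.Measure.ext_of_lipschitz {X : Type*} [PseudoEMetricSpace X]
    [MeasurableSpace X] [BorelSpace X] {μ ν : Measure X} [IsFiniteMeasure μ] [IsFiniteMeasure ν]
    (h : ∀ (K : ℝ≥0) (F : X → ℝ≥0), LipschitzWith K F → (∀ p, F p ≤ 1) →
      ∫⁻ p, F p ∂μ = ∫⁻ p, F p ∂ν) : μ = ν := by
  have hδ : ∀ n : ℕ, (0 : ℝ) < 1 / (n + 1) := fun n => Nat.one_div_pos_of_nat
  have hclosed : ∀ s : Set X, IsClosed s → μ s = ν s := fun s hs =>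
    tendsto_nhds_unique
      (tendsto_lintegral_thickenedIndicator_of_isClosed μ hs hδ
        tendsto_one_div_add_atTop_nhds_zero_nat)
      ((tendsto_lintegral_thickenedIndicator_of_isClosed ν hs hδ
        tendsto_one_div_add_atTop_nhds_zero_nat).congr fun n =>
          (h _ _ (lipschitzWith_thickenedIndicator (hδ n) s)
            (thickenedIndicator_le_one (hδ n) s)).symm)
  refine ext_of_generate_finite _ ?_ isPiSystem_isClosed hclosed (hclosed univ isClosed_univ)
  rw [BorelSpace.measurable_eq (α := X), borel_eq_generateFrom_isClosed]

namespace IsPoissonPointProcess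

variable {Ω M : Type*} [MeasurableSpace Ω] {P : Measure Ω} [IsProbabilityMeasure P]
  [MetricSpace M] [SecondCountableTopology M] [MeasurableSpace M] [BorelSpace M]
  {Λ : Measure M} {N : Ω → Set M} {A : Set M} {n₁ n₂ : ℕ} {ν : Measure (ℝ × ℝ)} {a : ℝ} {d : ℕ}

/-- The bounds of `campbell_cell_bounds`, summed over a partition of `A` into small cells. -/
lemma campbell_bounds [Nonempty M] (hN : IsPoissonPointProcess N Λ P)
    (hG : ∀ᵐ ω ∂P, IsInfiniteLocallyFinite (N ω))
    (hlaw : ∀ y, HasLaw (fun ω => (kthDist (N ω) y n₁, kthDist (N ω) y n₂)) ν P)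
    (hA : MeasurableSet A) (hΛA : Λ A ≠ ∞) {ε : ℝ} (hε : 0 < ε) {η : ℝ≥0∞}
    (hΛ : ∀ x, Λ (Metric.closedBall x ε) ≤ η)
    {K : ℝ≥0} {F : ℝ × ℝ → ℝ≥0} (hF : LipschitzWith K F) (hF1 : ∀ p, F p ≤ 1) :
    (∫⁻ ω, ∫⁻ x in N ω ∩ A, F (nnDist (N ω) x n₁, nnDist (N ω) x n₂) ∂Measure.count ∂P ≤
      Λ A * (∫⁻ p, F p ∂ν + (K * ENNReal.ofReal ε + 2 * η))) ∧
    (Λ A * ∫⁻ p, F p ∂ν ≤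
      ∫⁻ ω, ∫⁻ x in N ω ∩ A, F (nnDist (N ω) x n₁, nnDist (N ω) x n₂) ∂Measure.count ∂P +
      Λ A * (K * ENNReal.ofReal ε + 2 * η)) := by
  let y := TopologicalSpace.denseSeq M
  let D : ℕ → Set M := disjointed fun i => Metric.closedBall (y i) ε
  have hD : ∀ i, MeasurableSet (D i) := fun i =>
    .disjointed (fun i => Metric.isClosed_closedBall.measurableSet) i
  have hDy : ∀ i, D i ⊆ Metric.closedBall (y i) ε := fun i => disjointed_subset _ i
  have hDu : ⋃ i, D i = univ := by
    rw [iUnion_disjointed, eq_univ_iff_forall]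
    intro x
    obtain ⟨i, hi⟩ := (TopologicalSpace.denseRange_denseSeq M).exists_dist_lt x hε
    exact mem_iUnion.2 ⟨i, hi.le⟩
  have hDd : Pairwise fun i j => Disjoint (D i) (D j) := disjoint_disjointed _
  have hAD : ∀ i, MeasurableSet (A ∩ D i) := fun i => hA.inter (hD i)
  have hΛAD : ∀ i, Λ (A ∩ D i) ≠ ∞ := fun i => measure_ne_top_of_subset inter_subset_left hΛA
  have hη' : ∀ i, Λ (A ∩ D i) ≤ η := fun i =>
    (measure_mono (inter_subset_right.trans (hDy i))).trans (hΛ _)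
  have hsumA : ∑' i, Λ (A ∩ D i) = Λ A := by
    rw [← measure_iUnion (fun i j hij => (hDd hij).mono inter_subset_right inter_subset_right) hAD,
      ← inter_iUnion, hDu, inter_univ]
  have hFm : Measurable fun p => (F p : ℝ≥0∞) := hF.continuous.measurable.coe_nnreal_ennreal
  have hsum : ∫⁻ ω, ∫⁻ x in N ω ∩ A, F (nnDist (N ω) x n₁, nnDist (N ω) x n₂) ∂Measure.count ∂P =
      ∑' i, ∫⁻ ω, ∫⁻ x in N ω ∩ (A ∩ D i),
        F (nnDist (N ω) x n₁, nnDist (N ω) x n₂) ∂Measure.count ∂P := by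
    rw [← lintegral_tsum]
    · refine lintegral_congr fun ω => ?_
      rw [← lintegral_iUnion (fun i => (hN.countable ω).measurableSet.inter (hAD i)),
        ← inter_iUnion, ← inter_iUnion, hDu, inter_univ]
      intro i j hij
      exact (hDd hij).mono (inter_subset_right.trans inter_subset_right)
        (inter_subset_right.trans inter_subset_right)
    · intro i
      obtain ⟨μ, hμ⟩ := hN.exists_campbell (n₁ := n₁) (n₂ := n₂) hG (hAD i) (hΛAD i)
      exact (hμ _ hFm).1
  have hcell := fun i => hN.campbell_cell_bounds hG (hlaw (y i)) (hAD i) (hΛAD i)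
    (inter_subset_right.trans (hDy i)) hF hF1
  rw [hsum, ← hsumA, ← ENNReal.tsum_mul_right, ← ENNReal.tsum_mul_right, ← ENNReal.tsum_mul_right,
    ← ENNReal.tsum_add]
  constructor
  · refine ENNReal.tsum_le_tsum fun i => (hcell i).1.trans ?_
    gcongr
    exact hη' i
  · refine ENNReal.tsum_le_tsum fun i => (hcell i).2.trans ?_
    gcongr
    exact hη' i

/-- The Palm distribution of the nearest neighbour distances is their law at a fixed location. -/
theorem lintegral_sum_nnDist [Nonempty M] (hN : IsPoissonPointProcess N Λ P)
    (ha : 0 < a) (hd : 1 ≤ d)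
    (hΛ : ∀ x r, 0 < r → Λ (Metric.closedBall x r) = ENNReal.ofReal (a * r ^ d))
    (hlaw : ∀ y, HasLaw (fun ω => (kthDist (N ω) y n₁, kthDist (N ω) y n₂)) ν P)
    (hA : MeasurableSet A) (hΛA : Λ A ≠ ∞) {F : ℝ × ℝ → ℝ≥0∞} (hF : Measurable F) :
    ∫⁻ ω, ∫⁻ x in N ω ∩ A, F (nnDist (N ω) x n₁, nnDist (N ω) x n₂) ∂Measure.count ∂P =
      Λ A * ∫⁻ p, F p ∂ν := by
  have hG := hN.ae_isInfiniteLocallyFinite ha hd hΛ (Classical.arbitrary M)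
  have hν : IsProbabilityMeasure ν :=
    (hlaw (Classical.arbitrary M)).isProbabilityMeasure_iff.1 inferInstance
  obtain ⟨μ, hμ⟩ := hN.exists_campbell (n₁ := n₁) (n₂ := n₂) hG hA hΛA
  have hμu : μ univ = Λ A := by
    have h := (hμ (fun _ => 1) measurable_const).2
    simp only [lintegral_const, one_mul, Measure.restrict_apply .univ, univ_inter] at h
    rw [h, ← hN.lintegral_count hA hΛA]
    exact lintegral_congr fun ω =>
      Measure.count_apply ((hN.countable ω).measurableSet.inter hA)
  have : IsFiniteMeasure μ := ⟨by rw [hμu]; exact hΛA.lt_top⟩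
  have : IsFiniteMeasure (Λ A • ν) := ν.smul_finite hΛA
  have hμν : μ = Λ A • ν := by
    refine Measure.ext_of_lipschitz fun K G hGL hG1 => ?_
    have hGm : Measurable fun p => (G p : ℝ≥0∞) := hGL.continuous.measurable.coe_nnreal_ennreal
    rw [lintegral_smul_measure, smul_eq_mul, (hμ _ hGm).2]
    have hb := fun (ε : ℝ) (hε : 0 < ε) => hN.campbell_bounds hG hlaw hA hΛA hε
      (fun x => (hΛ x ε hε).le) hGL hG1
    have herr : Filter.Tendsto
        (fun ε : ℝ => K * ENNReal.ofReal ε + 2 * ENNReal.ofReal (a * ε ^ d))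
        (nhdsWithin 0 (Ioi 0)) (nhds 0) := by
      have h1 : Filter.Tendsto (fun ε : ℝ => K * ENNReal.ofReal ε) (nhds 0)
          (nhds (K * ENNReal.ofReal 0)) :=
        ENNReal.Tendsto.const_mul (ENNReal.continuous_ofReal.tendsto 0)
          (Or.inr ENNReal.coe_ne_top)
      have h2 : Filter.Tendsto (fun ε : ℝ => 2 * ENNReal.ofReal (a * ε ^ d)) (nhds 0)
          (nhds (2 * ENNReal.ofReal (a * 0 ^ d))) :=
        ENNReal.Tendsto.const_mul ((ENNReal.continuous_ofReal.comp
          (by fun_prop : Continuous fun ε : ℝ => a * ε ^ d)).tendsto 0) (Or.inr (by simp))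
      have h := h1.add h2
      rw [zero_pow (by omega), mul_zero, ENNReal.ofReal_zero, mul_zero, mul_zero, add_zero] at h
      exact h.mono_left nhdsWithin_le_nhds
    refine le_antisymm ?_ ?_
    · have hlim := ENNReal.Tendsto.const_mul (a := Λ A)
        ((tendsto_const_nhds (x := ∫⁻ p, G p ∂ν)).add herr) (Or.inr hΛA)
      rw [add_zero] at hlim
      exact ge_of_tendsto hlim (eventually_nhdsWithin_of_forall fun ε hε => (hb ε hε).1)
    · have hlim := (tendsto_const_nhds (x := ∫⁻ ω, ∫⁻ x in N ω ∩ A,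
        (G (nnDist (N ω) x n₁, nnDist (N ω) x n₂) : ℝ≥0∞) ∂Measure.count ∂P)).add
        (ENNReal.Tendsto.const_mul (a := Λ A) herr (Or.inr hΛA))
      rw [mul_zero, add_zero] at hlim
      exact ge_of_tendsto hlim (eventually_nhdsWithin_of_forall fun ε hε => (hb ε hε).2)
  rw [← (hμ F hF).2, hμν, lintegral_smul_measure, smul_eq_mul]

lemma typicalMean_eq_lintegral [Nonempty M] (hN : IsPoissonPointProcess N Λ P)
    (ha : 0 < a) (hd : 1 ≤ d)
    (hΛ : ∀ x r, 0 < r → Λ (Metric.closedBall x r) = ENNReal.ofReal (a * r ^ d))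
    (hlaw : ∀ y, HasLaw (fun ω => (kthDist (N ω) y n₁, kthDist (N ω) y n₂)) ν P)
    (hA : MeasurableSet A) (hΛ0 : Λ A ≠ 0) (hΛA : Λ A ≠ ∞) {F : ℝ × ℝ → ℝ≥0∞}
    (hF : Measurable F) :
    typicalMean P N A (fun S x => F (nnDist S x n₁, nnDist S x n₂)) = ∫⁻ p, F p ∂ν := by
  have hsum : ∀ ω, ∑' x : ↥(N ω ∩ A), F (nnDist (N ω) x n₁, nnDist (N ω) x n₂) =
      ∫⁻ x in N ω ∩ A, F (nnDist (N ω) x n₁, nnDist (N ω) x n₂) ∂Measure.count := by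
    intro ω
    rw [lintegral_countable _ ((hN.countable ω).mono inter_subset_left)]
    simp
  rw [typicalMean, hN.lintegral_count hA hΛA]
  simp_rw [hsum]
  rw [hN.lintegral_sum_nnDist ha hd hΛ hlaw hA hΛA hF, mul_comm,
    ENNReal.mul_div_cancel_right hΛ0 hΛA]

end IsPoissonPointProcess

end

/-! ### The ratio of two nearest neighbour distances -/

theorem theorem3 {Ω M : Type*} [MeasurableSpace Ω] (P : Measure Ω) [IsProbabilityMeasure P]
    [MetricSpace M] [SecondCountableTopology M] [MeasurableSpace M] [BorelSpace M]
    -- volume on the data space: balls of radius `r` have volume `c * r ^ d`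
    (vol : Measure M) (d : ℕ) (hd : 1 ≤ d) (c : ℝ) (hc : 0 < c)
    (hvol : ∀ (x : M) (r : ℝ), 0 < r → vol (Metric.closedBall x r) = ENNReal.ofReal (c * r ^ d))
    -- homogeneous Poisson process of density `ρ`
    (ρ : ℝ) (hρ : 0 < ρ) (N : Ω → Set M)
    (hN : IsPoissonPointProcess N (ENNReal.ofReal ρ • vol) P)
    (n₁ n₂ : ℕ) (hn₁ : 1 ≤ n₁) (hn : n₁ < n₂) :
    -- a fixed observation `x`, its neighbours being the points of the process
    (∀ x : M,
      HasLaw (fun ω => nnRatio (N ω) n₁ n₂ x) (nnRatioLaw d n₁ n₂) P ∧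
      HasLaw (fun ω => nnRatio (N ω) n₁ n₂ x ^ d - 1) (betaPrimeLaw ((n₂ : ℝ) - n₁) n₁) P ∧
      ∀ k : ℝ, k < d * n₁ →
        Integrable (fun ω => nnRatio (N ω) n₁ n₂ x ^ k) P ∧
        ∫ ω, nnRatio (N ω) n₁ n₂ x ^ k ∂P =
          beta ((n₂ : ℝ) - n₁) (n₁ - k / d) / beta ((n₂ : ℝ) - n₁) n₁) ∧
    -- a typical observation of the process, sampled in an arbitrary window `A`
    (∀ A : Set M, MeasurableSet A → vol A ≠ 0 → vol A ≠ ∞ →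
      (∀ B : Set ℝ, MeasurableSet B →
        typicalProb P N A (fun S x => nnRatio S n₁ n₂ x) B = nnRatioLaw d n₁ n₂ B) ∧
      (∀ B : Set ℝ, MeasurableSet B →
        typicalProb P N A (fun S x => nnRatio S n₁ n₂ x ^ d - 1) B =
          betaPrimeLaw ((n₂ : ℝ) - n₁) n₁ B) ∧
      ∀ k : ℝ, k < d * n₁ →
        typicalMean P N A (fun S x => ENNReal.ofReal (nnRatio S n₁ n₂ x ^ k)) =
          ENNReal.ofReal
            (beta ((n₂ : ℝ) - n₁) (n₁ - k / d) / beta ((n₂ : ℝ) - n₁) n₁)) := by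
  obtain ⟨n, rfl⟩ : ∃ n, n₁ = n + 1 := ⟨n₁ - 1, by omega⟩
  obtain ⟨m, rfl⟩ : ∃ m, n₂ = n + m + 2 := ⟨n₂ - n - 2, by omega⟩
  have e1 : ((n + m + 2 : ℕ) : ℝ) - (n + 1 : ℕ) = m + 1 := by push_cast; ring
  have e2 : ((n + 1 : ℕ) : ℝ) = n + 1 := by push_cast; ring
  rw [e1, e2]
  have ha : 0 < ρ * c := mul_pos hρ hc
  have hρ0 : ENNReal.ofReal ρ ≠ 0 := by simpa using hρ
  have hΛ : ∀ x r, 0 < r →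
      (ENNReal.ofReal ρ • vol) (Metric.closedBall x r) = ENNReal.ofReal (ρ * c * r ^ d) := by
    intro x r hr
    rw [Measure.smul_apply, smul_eq_mul, hvol x r hr, ← ENNReal.ofReal_mul hρ.le, mul_assoc]
  have hratio := hasLaw_ratio (n := n) (m := m) ha hd
  have hpow := hasLaw_ratio_pow_sub_one (n := n) (m := m) ha hd
  refine ⟨fun x => ?_, fun A hA hA0 hAtop => ?_⟩
  · have hx := hN.hasLaw_nnDist ha hd hΛ x n m
    refine ⟨hratio.fun_comp hx, hpow.fun_comp hx, fun k hk => ?_⟩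
    have hmeas : AEMeasurable (fun ω => nnRatio (N ω) (n + 1) (n + m + 2) x ^ k) P :=
      (hratio.fun_comp hx).aemeasurable.pow_const k
    have hnonneg : ∀ ω, 0 ≤ nnRatio (N ω) (n + 1) (n + m + 2) x ^ k := fun ω =>
      Real.rpow_nonneg (div_nonneg kthDist_nonneg kthDist_nonneg) _
    have hint : ∫⁻ ω, ENNReal.ofReal (nnRatio (N ω) (n + 1) (n + m + 2) x ^ k) ∂P =
        ENNReal.ofReal (beta (m + 1) (n + 1 - k / d) / beta (m + 1) (n + 1)) := by
      rw [← lintegral_ratio_rpow ha hd hk]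
      exact hx.lintegral_comp (f := fun p => ENNReal.ofReal ((p.2 / p.1) ^ k)) (by fun_prop)
    have hd0 : (0 : ℝ) < d := by exact_mod_cast hd
    have hk' : 0 < (n : ℝ) + 1 - k / d := sub_pos.2 (by rwa [div_lt_iff₀' hd0])
    refine ⟨⟨hmeas.aestronglyMeasurable, ?_⟩, ?_⟩
    · rw [hasFiniteIntegral_iff_ofReal (.of_forall hnonneg), hint]
      exact ENNReal.ofReal_lt_top
    · rw [integral_eq_lintegral_of_nonneg_ae (.of_forall hnonneg) hmeas.aestronglyMeasurable, hint,
        ENNReal.toReal_ofReal]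
      exact (div_pos (beta_pos (by positivity) hk') (beta_pos (by positivity) (by positivity))).le
  · have : Nonempty M := by
      obtain ⟨x, -⟩ := nonempty_of_measure_ne_zero hA0
      exact ⟨x⟩
    have hA0' : (ENNReal.ofReal ρ • vol) A ≠ 0 := mul_ne_zero hρ0 hA0
    have hAtop' : (ENNReal.ofReal ρ • vol) A ≠ ∞ := ENNReal.mul_ne_top ENNReal.ofReal_ne_top hAtop
    have hlaw := fun y => hN.hasLaw_kthDist ha hd hΛ y n m
    have hmean := fun (F : ℝ × ℝ → ℝ≥0∞) (hF : Measurable F) =>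
      hN.typicalMean_eq_lintegral ha hd hΛ hlaw hA hA0' hAtop' hF
    have hprob : ∀ {g : ℝ × ℝ → ℝ} {μ : Measure ℝ}, Measurable g →
        HasLaw g μ (neighbourDistLaw (ρ * c) d n m) → ∀ B, MeasurableSet B →
        typicalProb P N A (fun S x => g (nnDist S x (n + 1), nnDist S x (n + m + 2))) B = μ B := by
      intro g μ hg hgμ B hB
      rw [← hgμ.map_eq, Measure.map_apply hg hB, ← lintegral_indicator_one (hg hB)]
      exact hmean (fun p => B.indicator (fun _ => 1) (g p))
        ((measurable_const.indicator hB).comp hg)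
    refine ⟨hprob (by fun_prop) hratio, hprob (by fun_prop) hpow, fun k hk => ?_⟩
    rw [← lintegral_ratio_rpow ha hd hk]
    exact hmean (fun p => ENNReal.ofReal ((p.2 / p.1) ^ k)) (by fun_prop)
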